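/- Let $n\ge 1$, $\gamma>1$, $g(t)=e^{-\gamma t}$, and consider the Cauchy problem on $\mathbb{R}^n$ $$u_{tt}-\Delta u-\Delta u_t+g*\Delta u=0\quad(t>0),\qquad (u,u_t)(0,\cdot)=(u_0,u_1),\qquad (g*\Delta u)(t)=\int_0^t g(t-\eta)\,\Delta u(\eta)\,d\eta .$$ Let $L^{1,1}(\mathbb{R}^n)$ be the space of $f\in L^1(\mathbb{R}^n)$ with $\|f\|_{L^{1,1}}=\int(1+|x|)|f(x)|\,dx<\infty$, and put $P_f=\int f(x)\,dx$ and $\hat f(\xi)=\int e^{-ix\cdot\xi}f(x)\,dx$. For $t>0$ let $J_j(t,|\cdot|)\in L^2(\mathbb{R}^n)$ be the inverse Fourier transform of $\hat J_j(t,|\xi|)=\hat J_{j,1}(t,|\xi|)+\hat J_{j,2}(t,|\xi|)$, $j=0,1$, where, with the upper sign for the second index $1$ and the lower sign for the second index $2$, $$\hat J_{0,1/2}(t,r)=\frac{\pm i\sqrt{\gamma(\gamma-1)}+\frac{(\gamma-1)^2}{2\gamma}r}{\pm2i\sqrt{\gamma(\gamma-1)}-\frac{2(\gamma-1)}{\gamma}r}\;e^{\pm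 i\sqrt{\frac{\gamma-1}{\gamma}}\,rt-\frac{\gamma^2+1}{2\gamma^2}r^2t},$$ $$\hat J_{1,1/2}(t,r)=\frac{\gamma\pm i\sqrt{\frac{\gamma-1}{\gamma}}\,r-\frac{\gamma^2+1}{2\gamma^2}r^2}{\pm2i\sqrt{\gamma(\gamma-1)}\,r-\frac{2(\gamma-1)}{\gamma}r^2}\;e^{\pm i\sqrt{\frac{\gamma-1}{\gamma}}\,rt-\frac{\gamma^2+1}{2\gamma^2}r^2t}.$$ Then there is $\varepsilon_0>0$ such that for every $0<\varepsilon\le\varepsilon_0$ and every real-valued $\chi\in C^\infty(\mathbb{R}^n)$ with support in $\{|\xi|<\varepsilon\}$ and $\chi=1$ on $\{|\xi|<\varepsilon/2\}$ there are constants $C>0$ and $T\ge1$ with the following property. For all complex-valued $u_0,u_1\in L^{1,1}(\mathbb{R}^n)$, every solution $u$ of the Cauchy problem with values in the tempered distributions (that is, $u$ is continuously differentiable in time on $[0,\infty)$ and twice differentiable on $(0,\infty)$ after pairing with any Schwartz function, the time derivatives being tempered distributions, and the equation and the initial conditions hold in $\mathcal{S}'(\mathbb{R}^n)$), and every $t\ge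 T$, the distribution $\chi(D)\big(u(t,\cdot)-(J_0(t,|\cdot|)P_{u_0}+J_1(t,|\cdot|)P_{u_1})\big)$ belongs to $L^2(\mathbb{R}^n)$ and $$\big\|\chi(D)\big(u(t,\cdot)-(J_0(t,|\cdot|)P_{u_0}+J_1(t,|\cdot|)P_{u_1})\big)\big\|_{L^2(\mathbb{R}^n)}\le C\Big(t^{-\frac12-\frac n4}\|u_0\|_{L^{1,1}}+t^{-\frac n4}\|u_1\|_{L^{1,1}}\Big).$$ Here $\chi(D)$ denotes the Fourier multiplier $\widehat{\chi(D)f}=\chi\hat f$. -/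

import Mathlib

open MeasureTheory Set
open scoped SchwartzMap FourierTransform Laplacian ENNReal ContDiff

noncomputable section

namespace ViscoelasticMemory

/-- The Euclidean space `ℝⁿ`. -/
abbrev Rn (n : ℕ) : Type := EuclideanSpace ℝ (Fin n)

/-- Membership in the weighted space `L^{1,1}(ℝⁿ)`. -/
def MemL11 {n : ℕ} (f : Rn n → ℂ) : Prop :=
  Integrable f ∧ Integrable (fun x => (1 + ‖x‖) * ‖f x‖)

/-- The norm `‖f‖_{L^{1,1}} = ∫ (1 + |x|) |f(x)| dx`. -/
def normL11 {n : ℕ} (f : Rn n → ℂ) : ℝ := ∫ x, (1 + ‖x‖) * ‖f x‖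

/-- The relaxation function `g(t) = e^{-γ t}`. -/
def relaxation (γ t : ℝ) : ℝ := Real.exp (-γ * t)

/-- `u` is a solution of the Cauchy problem
`u_tt - Δu - Δu_t + g ∗ Δu = 0` for `t > 0`, `u(0) = u₀`, `u_t(0) = u₁`, with values in the
tempered distributions on `ℝⁿ`; `v` is `u_t` and `a` is `u_tt`.  All time derivatives are taken in
the topology of `𝓢'`, i.e. after pairing with an arbitrary Schwartz function. -/
def IsSolution {n : ℕ} (γ : ℝ) (u₀ u₁ : Rn n → ℂ) (u : ℝ → 𝓢'(Rn n, ℂ)) : Prop :=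
  ∃ v a : ℝ → 𝓢'(Rn n, ℂ), ∀ φ : 𝓢(Rn n, ℂ),
    (∀ t : ℝ, 0 ≤ t → HasDerivWithinAt (fun s => u s φ) (v t φ) (Ici 0) t) ∧
    ContinuousOn (fun t => v t φ) (Ici 0) ∧
    (∀ t : ℝ, 0 < t → HasDerivAt (fun s => v s φ) (a t φ) t) ∧
    u 0 φ = ∫ x, φ x * u₀ x ∧
    v 0 φ = ∫ x, φ x * u₁ x ∧
    ∀ t : ℝ, 0 < t →
      a t φ - (Δ (u t)) φ - (Δ (v t)) φ
        + ∫ η in (0 : ℝ)..t, (relaxation γ (t - η) : ℂ) * (Δ (u η)) φ = 0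

/-- A low-frequency cut-off: smooth, supported in `|ξ| < ε`, equal to `1` for `|ξ| < ε / 2`. -/
structure IsLowCutoff {n : ℕ} (ε : ℝ) (χ : Rn n → ℝ) : Prop where
  smooth : ContDiff ℝ ∞ χ
  support : tsupport χ ⊆ Metric.ball 0 ε
  eq_one : ∀ ξ ∈ Metric.ball (0 : Rn n) (ε / 2), χ ξ = 1

/-- The operator `χ(D)` with `D = -i∇`: it multiplies `∫ e^{-i x·ξ} f(x) dx` by `χ(ξ)`.  As Mathlib
transforms with `e^{-2π i x·ξ}`, the multiplier is rescaled by `2π`. -/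
def frequencyCutoff {n : ℕ} (χ : Rn n → ℝ) : 𝓢'(Rn n, ℂ) →L[ℂ] 𝓢'(Rn n, ℂ) :=
  TemperedDistribution.fourierMultiplierCLM ℂ (fun ξ => ((χ ((2 * Real.pi) • ξ) : ℝ) : ℂ))

/-- The exponential `exp(± i √((γ-1)/γ) r t - (γ²+1)/(2γ²) r² t)`, where `σ = ± 1`. -/
def waveFactor (γ t σ r : ℝ) : ℂ :=
  Complex.exp ((σ : ℂ) * Complex.I * (√((γ - 1) / γ) : ℝ) * r * t
    - ((γ ^ 2 + 1) / (2 * γ ^ 2) : ℝ) * r ^ 2 * t)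

/-- The leading symbols `Ĵ_{0,1}` (`σ = 1`) and `Ĵ_{0,2}` (`σ = -1`) at `|ξ| = r`. -/
def symbolJ0Part (γ t σ r : ℝ) : ℂ :=
  ((σ : ℂ) * Complex.I * (√(γ * (γ - 1)) : ℝ) + ((γ - 1) ^ 2 / (2 * γ) : ℝ) * r)
    / ((σ : ℂ) * 2 * Complex.I * (√(γ * (γ - 1)) : ℝ) - (2 * (γ - 1) / γ : ℝ) * r)
    * waveFactor γ t σ r

/-- The leading symbols `Ĵ_{1,1}` (`σ = 1`) and `Ĵ_{1,2}` (`σ = -1`) at `|ξ| = r > 0`. -/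
def symbolJ1Part (γ t σ r : ℝ) : ℂ :=
  ((γ : ℂ) + (σ : ℂ) * Complex.I * (√((γ - 1) / γ) : ℝ) * r
      - ((γ ^ 2 + 1) / (2 * γ ^ 2) : ℝ) * r ^ 2)
    / ((σ : ℂ) * 2 * Complex.I * (√(γ * (γ - 1)) : ℝ) * r - (2 * (γ - 1) / γ : ℝ) * r ^ 2)
    * waveFactor γ t σ r

/-- `Ĵ₀ = Ĵ_{0,1} + Ĵ_{0,2}`. -/
def symbolJ0 (γ t r : ℝ) : ℂ := symbolJ0Part γ t 1 r + symbolJ0Part γ t (-1) r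

/-- `Ĵ₁ = Ĵ_{1,1} + Ĵ_{1,2}`. -/
def symbolJ1 (γ t r : ℝ) : ℂ := symbolJ1Part γ t 1 r + symbolJ1Part γ t (-1) r

lemma norm_waveFactor (γ t σ r : ℝ) :
    ‖waveFactor γ t σ r‖ = Real.exp (-((γ ^ 2 + 1) / (2 * γ ^ 2) * t) * r ^ 2) := by
  rw [waveFactor, Complex.norm_exp]
  congr 1
  simp only [Complex.sub_re, Complex.mul_re, Complex.mul_im, Complex.ofReal_re, Complex.ofReal_im,
    Complex.I_re, Complex.I_im, ← Complex.ofReal_pow]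
  ring

/-- Lower bound for the denominators. -/
lemma le_norm_den (p q : ℝ) (hp : 0 ≤ p) (σ : ℝ) (hσ : σ = 1 ∨ σ = -1) :
    p ≤ ‖(σ : ℂ) * 2 * Complex.I * (p : ℝ) - (q : ℝ)‖ := by
  have h := Complex.abs_im_le_norm ((σ : ℂ) * 2 * Complex.I * (p : ℝ) - (q : ℝ))
  refine le_trans ?_ h
  rcases hσ with rfl | rfl <;> simp [abs_of_nonneg hp] <;> linarith

lemma den_ne_zero (p q : ℝ) (hp : 0 < p) (σ : ℝ) (hσ : σ = 1 ∨ σ = -1) :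
    (σ : ℂ) * 2 * Complex.I * (p : ℝ) - (q : ℝ) ≠ 0 := by
  have := le_norm_den p q hp.le σ hσ
  intro h
  rw [h, norm_zero] at this
  linarith

lemma sqrt_pos_aux {γ : ℝ} (hγ : 1 < γ) : 0 < √(γ * (γ - 1)) :=
  Real.sqrt_pos.2 (mul_pos (by linarith) (by linarith))

/-- `r · Ĵ_{1,k}`, without the singularity at `r = 0`. -/
def regularJ1Part (γ t σ r : ℝ) : ℂ :=
  ((γ : ℂ) + (σ : ℂ) * Complex.I * (√((γ - 1) / γ) : ℝ) * r
      - ((γ ^ 2 + 1) / (2 * γ ^ 2) : ℝ) * r ^ 2)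
    / ((σ : ℂ) * 2 * Complex.I * (√(γ * (γ - 1)) : ℝ) - (2 * (γ - 1) / γ * r : ℝ))
    * waveFactor γ t σ r

lemma symbolJ1Part_eq (γ t σ r : ℝ) :
    symbolJ1Part γ t σ r = regularJ1Part γ t σ r / r := by
  have : (σ : ℂ) * 2 * Complex.I * (√(γ * (γ - 1)) : ℝ) * r - (2 * (γ - 1) / γ : ℝ) * r ^ 2
      = ((σ : ℂ) * 2 * Complex.I * (√(γ * (γ - 1)) : ℝ) - (2 * (γ - 1) / γ * r : ℝ)) * r := by
    push_cast
    ring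
  rw [symbolJ1Part, this, regularJ1Part, ← div_div, div_mul_eq_mul_div]

lemma differentiable_regularJ1Part {γ : ℝ} (hγ : 1 < γ) (t σ : ℝ) (hσ : σ = 1 ∨ σ = -1) :
    Differentiable ℝ (regularJ1Part γ t σ) := by
  have hof : Differentiable ℝ (fun r : ℝ => (r : ℂ)) := Complex.ofRealCLM.differentiable
  unfold regularJ1Part waveFactor
  refine Differentiable.mul (Differentiable.div (by fun_prop) ?_ ?_) (by fun_prop)
  · push_cast
    fun_prop
  · exact fun r => den_ne_zero _ _ (sqrt_pos_aux hγ) σ hσ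

lemma norm_symbolJ0Part_le {γ : ℝ} (hγ : 1 < γ) (t σ r : ℝ) (hσ : σ = 1 ∨ σ = -1) (hr : 0 ≤ r) :
    ‖symbolJ0Part γ t σ r‖ ≤
      ((√(γ * (γ - 1)) + (γ - 1) ^ 2 / (2 * γ)) / √(γ * (γ - 1))) * (1 + r ^ 2)
        * Real.exp (-((γ ^ 2 + 1) / (2 * γ ^ 2) * t) * r ^ 2) := by
  have hp := sqrt_pos_aux hγ
  set p := √(γ * (γ - 1)) with hpdef
  have hq : 0 ≤ (γ - 1) ^ 2 / (2 * γ) := by positivity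
  have hσn : ‖(σ : ℂ)‖ = 1 := by rcases hσ with rfl | rfl <;> simp
  rw [symbolJ0Part, norm_mul, norm_waveFactor, norm_div]
  gcongr
  rw [div_mul_eq_mul_div]
  have hden := le_norm_den p (2 * (γ - 1) / γ * r) hp.le σ hσ
  rw [Complex.ofReal_mul] at hden
  refine div_le_div₀ (by positivity) ?_ hp hden
  refine (norm_add_le _ _).trans ?_
  rw [norm_mul, norm_mul, hσn, norm_mul, Complex.norm_I, Complex.norm_real, Complex.norm_real,
    Complex.norm_real, Real.norm_of_nonneg hp.le, Real.norm_of_nonneg hq, Real.norm_of_nonneg hr]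
  nlinarith [mul_nonneg hp.le (sq_nonneg r), mul_nonneg hq (sq_nonneg (r - 1)),
    mul_nonneg hq (sq_nonneg r)]

lemma norm_regularJ1Part_le {γ : ℝ} (hγ : 1 < γ) (t σ r : ℝ) (hσ : σ = 1 ∨ σ = -1) (hr : 0 ≤ r) :
    ‖regularJ1Part γ t σ r‖ ≤
      ((γ + √((γ - 1) / γ) + (γ ^ 2 + 1) / (2 * γ ^ 2)) / √(γ * (γ - 1))) * (1 + r ^ 2)
        * Real.exp (-((γ ^ 2 + 1) / (2 * γ ^ 2) * t) * r ^ 2) := by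
  have hp := sqrt_pos_aux hγ
  have hγ0 : 0 ≤ γ := by linarith
  have ha : 0 ≤ √((γ - 1) / γ) := Real.sqrt_nonneg _
  have hb : 0 ≤ (γ ^ 2 + 1) / (2 * γ ^ 2) := by positivity
  have hσn : ‖(σ : ℂ)‖ = 1 := by rcases hσ with rfl | rfl <;> simp
  rw [regularJ1Part, norm_mul, norm_waveFactor, norm_div]
  refine mul_le_mul_of_nonneg_right ?_ (Real.exp_pos _).le
  rw [div_mul_eq_mul_div _ (√(γ * (γ - 1))) (1 + r ^ 2)]
  have hden := le_norm_den (√(γ * (γ - 1))) (2 * (γ - 1) / γ * r) hp.le σ hσ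
  refine div_le_div₀ (by positivity) ?_ hp hden
  refine (norm_sub_le _ _).trans ((add_le_add_left (norm_add_le _ _) _).trans ?_)
  rw [norm_mul, norm_mul, norm_mul, norm_mul, norm_pow, hσn, Complex.norm_I, Complex.norm_real,
    Complex.norm_real, Complex.norm_real, Complex.norm_real, Real.norm_of_nonneg hγ0,
    Real.norm_of_nonneg ha, Real.norm_of_nonneg hb, Real.norm_of_nonneg hr]
  nlinarith [mul_nonneg hγ0 (sq_nonneg r), mul_nonneg ha (sq_nonneg (r - 1)),
    mul_nonneg ha (sq_nonneg r), mul_nonneg hb (sq_nonneg r)]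

/-- A measurable radial symbol with Gaussian decay is square integrable. -/
lemma memLp_two_of_gaussian_bound {n : ℕ} {f : ℝ → ℂ} (hf : Measurable f) {A b : ℝ} (hb : 0 < b)
    (h : ∀ r, 0 ≤ r → ‖f r‖ ≤ A * (1 + r ^ 2) * Real.exp (-b * r ^ 2)) :
    MemLp (fun ξ : Rn n => f (2 * Real.pi * ‖ξ‖)) 2 := by
  have hA : 0 ≤ A := by
    have := (norm_nonneg _).trans (h 0 le_rfl)
    simpa using this
  have hpi := Real.pi_pos
  set B : ℝ := A * (1 + 2 / b) with hB
  have hB0 : 0 ≤ B := by positivity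
  have key : ∀ r, 0 ≤ r → ‖f r‖ ≤ B * Real.exp (-(b / 2) * r ^ 2) := by
    intro r hr
    refine (h r hr).trans ?_
    have e : Real.exp (-b * r ^ 2) = Real.exp (-(b / 2) * r ^ 2) * Real.exp (-(b / 2) * r ^ 2) := by
      rw [← Real.exp_add]; ring_nf
    rw [e, ← mul_assoc]
    refine mul_le_mul_of_nonneg_right ?_ (Real.exp_pos _).le
    rw [hB, mul_assoc]
    refine mul_le_mul_of_nonneg_left ?_ hA
    have e1 : Real.exp (-(b / 2) * r ^ 2) ≤ 1 := Real.exp_le_one_iff.2 (by nlinarith [sq_nonneg r])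
    have e2 : b / 2 * r ^ 2 * Real.exp (-(b / 2) * r ^ 2) ≤ 1 := by
      have h1 := Real.add_one_le_exp (b / 2 * r ^ 2)
      have h2 : Real.exp (b / 2 * r ^ 2) * Real.exp (-(b / 2) * r ^ 2) = 1 := by
        rw [← Real.exp_add]; ring_nf; exact Real.exp_zero
      nlinarith [Real.exp_pos (-(b / 2) * r ^ 2)]
    have e3 : r ^ 2 * Real.exp (-(b / 2) * r ^ 2) ≤ 2 / b := by
      rw [le_div_iff₀ hb]; linarith
    linarith
  have hm : AEStronglyMeasurable (fun ξ : Rn n => f (2 * Real.pi * ‖ξ‖)) volume :=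
    (hf.comp (by fun_prop)).aestronglyMeasurable
  rw [memLp_two_iff_integrable_sq_norm hm]
  have hc : 0 < (((b * (2 * Real.pi) ^ 2 : ℝ)) : ℂ).re := by
    rw [Complex.ofReal_re]; positivity
  have hg := (GaussianFourier.integrable_cexp_neg_mul_sq_norm_add (V := Rn n) hc 0 0).norm
  refine (hg.const_mul (B ^ 2)).mono' (hm.norm.pow 2) (Filter.Eventually.of_forall fun ξ => ?_)
  have hk := key (2 * Real.pi * ‖ξ‖) (by positivity)
  rw [Real.norm_of_nonneg (by positivity)]
  refine (pow_le_pow_left₀ (norm_nonneg _) hk 2).trans (le_of_eq ?_)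
  rw [mul_pow, Complex.norm_exp, ← Real.exp_nat_mul]
  congr 2
  simp [← Complex.ofReal_pow]
  ring

lemma memLp_symbolJ0 (n : ℕ) {γ t : ℝ} (hγ : 1 < γ) (ht : 0 < t) :
    MemLp (fun ξ : Rn n => symbolJ0 γ t (2 * Real.pi * ‖ξ‖)) 2 := by
  have hb : 0 < (γ ^ 2 + 1) / (2 * γ ^ 2) * t := by positivity
  refine memLp_two_of_gaussian_bound (f := symbolJ0 γ t) ?_
    (A := 2 * ((√(γ * (γ - 1)) + (γ - 1) ^ 2 / (2 * γ)) / √(γ * (γ - 1)))) hb ?_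
  · unfold symbolJ0 symbolJ0Part waveFactor
    fun_prop
  · intro r hr
    refine (norm_add_le _ _).trans ?_
    have h1 := norm_symbolJ0Part_le hγ t 1 r (Or.inl rfl) hr
    have h2 := norm_symbolJ0Part_le hγ t (-1) r (Or.inr rfl) hr
    linarith

lemma memLp_symbolJ1 (n : ℕ) {γ t : ℝ} (hγ : 1 < γ) (ht : 0 < t) :
    MemLp (fun ξ : Rn n => symbolJ1 γ t (2 * Real.pi * ‖ξ‖)) 2 := by
  have hb : 0 < (γ ^ 2 + 1) / (2 * γ ^ 2) * t := by positivity
  set b := (γ ^ 2 + 1) / (2 * γ ^ 2) * t with hbdef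
  set F : ℝ → ℂ := fun r => regularJ1Part γ t 1 r + regularJ1Part γ t (-1) r with hF
  have hFd : Differentiable ℝ F :=
    (differentiable_regularJ1Part hγ t 1 (Or.inl rfl)).add
      (differentiable_regularJ1Part hγ t (-1) (Or.inr rfl))
  have hF0 : F 0 = 0 := by
    have hp : ((√(γ * (γ - 1)) : ℝ) : ℂ) ≠ 0 := by exact_mod_cast (sqrt_pos_aux hγ).ne'
    simp only [hF, regularJ1Part, waveFactor]
    simp
    field_simp
    ring
  have hJ : ∀ r, symbolJ1 γ t r = F r / r := fun r => by
    rw [symbolJ1, symbolJ1Part_eq, symbolJ1Part_eq, ← add_div]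
  have hcont : Continuous (dslope F 0) :=
    continuous_iff_continuousAt.2 fun x => by
      by_cases hx : x = 0
      · subst hx; exact continuousAt_dslope_same.2 (hFd 0)
      · exact (continuousAt_dslope_of_ne hx).2 (hFd x).continuousAt
  obtain ⟨M, hM⟩ := isCompact_Icc.exists_bound_of_continuousOn (s := Icc (0 : ℝ) 1)
    hcont.continuousOn
  have hM0 : 0 ≤ M := (norm_nonneg _).trans (hM 0 ⟨le_rfl, zero_le_one⟩)
  set K := (γ + √((γ - 1) / γ) + (γ ^ 2 + 1) / (2 * γ ^ 2)) / √(γ * (γ - 1)) with hK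
  have hK0 : 0 ≤ K := by
    have := sqrt_pos_aux hγ
    positivity
  refine memLp_two_of_gaussian_bound (f := symbolJ1 γ t) ?_
    (A := M * Real.exp b + 2 * K) hb ?_
  · unfold symbolJ1 symbolJ1Part waveFactor
    fun_prop
  · intro r hr
    rw [hJ]
    have hE := Real.exp_pos (-b * r ^ 2)
    rcases le_or_gt r 1 with h1 | h1
    · have hle : ‖F r / r‖ ≤ M := by
        rcases hr.eq_or_lt with rfl | hr'
        · simpa using hM0
        · have h2 := hM r ⟨hr, h1⟩
          rw [dslope_of_ne _ hr'.ne', slope_def_module, hF0, sub_zero, sub_zero] at h2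
          rw [norm_smul, norm_inv, ← div_eq_inv_mul] at h2
          rwa [norm_div, Complex.norm_real]
      have h3 : (1 : ℝ) ≤ Real.exp b * Real.exp (-b * r ^ 2) := by
        rw [← Real.exp_add]
        exact Real.one_le_exp (by
          have : r ^ 2 ≤ 1 := pow_le_one₀ hr h1
          nlinarith)
      have h4 : M ≤ M * Real.exp b * Real.exp (-b * r ^ 2) := by
        rw [mul_assoc]
        exact le_mul_of_one_le_right hM0 h3
      have h5 : M * Real.exp b * Real.exp (-b * r ^ 2) ≤
          (M * Real.exp b + 2 * K) * (1 + r ^ 2) * Real.exp (-b * r ^ 2) := by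
        refine mul_le_mul_of_nonneg_right ?_ hE.le
        have h6 : 0 ≤ M * Real.exp b := by positivity
        nlinarith [mul_nonneg h6 (sq_nonneg r), mul_nonneg hK0 (sq_nonneg r)]
      linarith
    · have h2 : ‖F r / r‖ ≤ ‖F r‖ := by
        rw [norm_div, Complex.norm_real, Real.norm_of_nonneg hr]
        exact div_le_self (norm_nonneg _) h1.le
      have h3 := norm_regularJ1Part_le hγ t 1 r (Or.inl rfl) hr
      have h4 := norm_regularJ1Part_le hγ t (-1) r (Or.inr rfl) hr
      have h5 : ‖F r‖ ≤ 2 * K * (1 + r ^ 2) * Real.exp (-b * r ^ 2) := by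
        refine (norm_add_le _ _).trans ?_
        linarith
      have h6 : 0 ≤ M * Real.exp b * (1 + r ^ 2) * Real.exp (-b * r ^ 2) := by positivity
      linarith

/-- The profile `J₀(t, |·|) ∈ L²(ℝⁿ)`, the inverse Fourier transform
`(2π)⁻ⁿ ∫ e^{i x·ξ} Ĵ₀(t, |ξ|) dξ`, written in Mathlib's normalization. -/
def profileJ0 (n : ℕ) {γ t : ℝ} (hγ : 1 < γ) (ht : 0 < t) : Lp ℂ 2 (volume : Measure (Rn n)) :=
  𝓕⁻ ((memLp_symbolJ0 n hγ ht).toLp _)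

/-- The profile `J₁(t, |·|) ∈ L²(ℝⁿ)`, the inverse Fourier transform
`(2π)⁻ⁿ ∫ e^{i x·ξ} Ĵ₁(t, |ξ|) dξ`, written in Mathlib's normalization. -/
def profileJ1 (n : ℕ) {γ t : ℝ} (hγ : 1 < γ) (ht : 0 < t) : Lp ℂ 2 (volume : Measure (Rn n)) :=
  𝓕⁻ ((memLp_symbolJ1 n hγ ht).toLp _)

end ViscoelasticMemory

end

noncomputable section

namespace ViscoelasticMemory

open Filter Topology

/-! ### Uniform boundedness on bounded sequences of Schwartz functions. -/

section UniformBoundedness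

variable {E : Type*} [NormedAddCommGroup E] [NormedSpace ℝ E]

/-! On the Fourier side, with `q = r²` the squared angular frequency, the triple `(û, û_t, g ∗ û)`
solves a linear system with the 3 × 3 generator `generatorConst γ + q • generatorSq`: an exponential
memory kernel makes the convolution one more state variable. The proof identifies the solution with
the flow of this system at low frequencies and then compares that flow with the profiles, frequency
by frequency.

Identification is not immediate, because `û` is only a distribution and cannot be evaluated at a
point. It is tested against `q^j φ` with `φ` supported where `q ≤ 1/4`. The resulting vectors
satisfy a hierarchy in which the equation at level `j` involves level `j + 1`. The functions `q^j φ`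
are bounded in every Schwartz seminorm, so Banach–Steinhaus bounds the hierarchy uniformly in `j`;
iterated integration then bounds the difference of two solutions by `K (cT)^k / k!` for all `k`, so
it vanishes (`eq_zero_of_hierarchy`, `IsSolution.apply_fourier`).

For small `r > 0` the characteristic cubic has a real root near `-γ` and a complex pair `-s/2 ± i
om`, with `om = a r + O(r³)`, `a = √((γ-1)/γ)`, and `s/2 = (γ²+1)/(2γ²) r² + O(r⁴)`
(`exists_charRoots`). The real root contributes exponentially small terms. In the oscillating modes
the exponents differ from those of the profiles by `O(r³ t)`, and the amplitudes by `O(r)` for `u₀`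
and `O(1)` for `u₁`, whose leading amplitude is of size `1/r`. Replacing `û_j(ξ)` by the mass of
`u_j` costs another factor `r ‖u_j‖_{L^{1,1}}`. The error is thus `O(r)` for `u₀` and `O(1)` for
`u₁`, times a Gaussian in `r √t` (`exists_pointwise_bound`). The factor `r` becomes `t^{-1/2}`, and
the `L²` norm of the Gaussian gives `t^{-n/4}`; Plancherel concludes. -/

lemma lp_one_summable (c : lp (fun _ : ℕ => ℂ) 1) : Summable fun j => ‖c j‖ := by
  simpa using c.2.summable

lemma lp_one_norm (c : lp (fun _ : ℕ => ℂ) 1) : ‖c‖ = ∑' j, ‖c j‖ := by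
  rw [lp.norm_eq_tsum_rpow (by norm_num)]
  simp

lemma norm_iteratedFDeriv_const_mul_schwartz (f : 𝓢(E, ℂ)) (c : ℂ) (l : ℕ) (x : E) :
    ‖iteratedFDeriv ℝ l (fun x => c * f x) x‖ = ‖c‖ * ‖iteratedFDeriv ℝ l f x‖ := by
  have := iteratedFDeriv_const_smul_apply' (𝕜 := ℝ) (i := l) (a := c) (f := f) (x := x)
    (f.smooth l).contDiffAt
  simp only [smul_eq_mul] at this
  rw [this, norm_smul]

section Series

variable {b : ℕ → 𝓢(E, ℂ)} {C : ℕ → ℕ → ℝ}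

lemma norm_iteratedFDeriv_term_le (hb : ∀ k l j, SchwartzMap.seminorm ℂ k l (b j) ≤ C k l)
    (c : lp (fun _ : ℕ => ℂ) 1) (l j : ℕ) (x : E) :
    ‖iteratedFDeriv ℝ l (fun x => c j * b j x) x‖ ≤ ‖c j‖ * C 0 l := by
  rw [norm_iteratedFDeriv_const_mul_schwartz]
  gcongr
  exact (SchwartzMap.norm_iteratedFDeriv_le_seminorm ℂ (b j) l x).trans (hb 0 l j)

lemma contDiff_schwartz_tsum (hb : ∀ k l j, SchwartzMap.seminorm ℂ k l (b j) ≤ C k l)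
    (c : lp (fun _ : ℕ => ℂ) 1) : ContDiff ℝ ∞ fun x => ∑' j, c j * b j x :=
  contDiff_tsum (v := fun l j => ‖c j‖ * C 0 l)
    (fun j => contDiff_const.mul ((b j).smooth ⊤))
    (fun _ _ => (lp_one_summable c).mul_right _)
    (fun l j x _ => norm_iteratedFDeriv_term_le hb c l j x)

lemma decay_schwartz_tsum (hb : ∀ k l j, SchwartzMap.seminorm ℂ k l (b j) ≤ C k l)
    (c : lp (fun _ : ℕ => ℂ) 1) (k l : ℕ) (x : E) :
    ‖x‖ ^ k * ‖iteratedFDeriv ℝ l (fun x => ∑' j, c j * b j x) x‖ ≤ C k l * ‖c‖ := by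
  rw [iteratedFDeriv_tsum_apply (N := ⊤) (v := fun l j => ‖c j‖ * C 0 l)
    (fun j => contDiff_const.mul ((b j).smooth ⊤))
    (fun _ _ => (lp_one_summable c).mul_right _)
    (fun l j x _ => norm_iteratedFDeriv_term_le hb c l j x) le_top]
  have hs : Summable fun j => ‖iteratedFDeriv ℝ l (fun x => c j * b j x) x‖ :=
    ((lp_one_summable c).mul_right (C 0 l)).of_nonneg_of_le (fun _ => norm_nonneg _)
      (fun j => norm_iteratedFDeriv_term_le hb c l j x)
  refine (mul_le_mul_of_nonneg_left (norm_tsum_le_tsum_norm hs) (by positivity)).trans ?_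
  rw [← tsum_mul_left, lp_one_norm, ← tsum_mul_left]
  refine (hs.mul_left _).tsum_le_tsum (fun j => ?_) ((lp_one_summable c).mul_left _)
  rw [norm_iteratedFDeriv_const_mul_schwartz, mul_left_comm, mul_comm (C k l)]
  gcongr
  exact (SchwartzMap.le_seminorm ℂ k l (b j) x).trans (hb k l j)

/-- The map `c ↦ ∑ c_j b_j` from `ℓ¹` to the Schwartz space, for a bounded sequence `b`. -/
def schwartzSeries (hb : ∀ k l j, SchwartzMap.seminorm ℂ k l (b j) ≤ C k l) :
    lp (fun _ : ℕ => ℂ) 1 →ₗ[ℂ] 𝓢(E, ℂ) where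
  toFun c :=
    { toFun := fun x => ∑' j, c j * b j x
      smooth' := contDiff_schwartz_tsum hb c
      decay' := fun k l => ⟨_, fun x => decay_schwartz_tsum hb c k l x⟩ }
  map_add' c d := by
    have hs (c : lp (fun _ : ℕ => ℂ) 1) (x : E) : Summable fun j => c j * b j x :=
      .of_norm (((lp_one_summable c).mul_right (C 0 0)).of_nonneg_of_le (fun _ => norm_nonneg _)
        fun j => by simpa using norm_iteratedFDeriv_term_le hb c 0 j x)
    ext x
    change ∑' j, (c + d) j * b j x = ∑' j, c j * b j x + ∑' j, d j * b j x
    rw [← (hs c x).tsum_add (hs d x)]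
    simp [add_mul]
  map_smul' a c := by
    ext x
    change ∑' j, (a • c) j * b j x = a * ∑' j, c j * b j x
    rw [← tsum_mul_left]
    simp [mul_assoc]

lemma schwartzSeries_single (hb : ∀ k l j, SchwartzMap.seminorm ℂ k l (b j) ≤ C k l) (j : ℕ) :
    schwartzSeries hb (lp.single 1 j 1) = b j := by
  ext x
  change ∑' i, (lp.single 1 j (1 : ℂ) : ∀ _, ℂ) i * b i x = b j x
  rw [tsum_eq_single j fun i hi => by simp [lp.single_apply, hi]]
  simp

lemma continuous_schwartzSeries (hb : ∀ k l j, SchwartzMap.seminorm ℂ k l (b j) ≤ C k l) :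
    Continuous (schwartzSeries hb) := by
  refine WithSeminorms.continuous_normedSpace_dom _ (schwartz_withSeminorms ℂ E ℂ) _ fun i => ?_
  have hC : 0 ≤ C i.1 i.2 := (apply_nonneg _ _).trans (hb i.1 i.2 0)
  refine ⟨⟨C i.1 i.2, hC⟩, fun c => ?_⟩
  exact SchwartzMap.seminorm_le_bound ℂ i.1 i.2 _ (mul_nonneg hC (apply_nonneg _ c))
    fun x => decay_schwartz_tsum hb c i.1 i.2 x

end Series

/-- A pointwise bounded family of functionals on the Schwartz space is uniformly bounded on every
sequence which is bounded in all seminorms. -/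
lemma exists_uniform_bound_of_pointwise {ι : Type*} (F : ι → 𝓢(E, ℂ) →L[ℂ] ℂ)
    (hF : ∀ φ, ∃ K : ℝ, ∀ i, ‖F i φ‖ ≤ K) (b : ℕ → 𝓢(E, ℂ))
    (hb : ∀ k l : ℕ, ∃ C : ℝ, ∀ j, SchwartzMap.seminorm ℂ k l (b j) ≤ C) :
    ∃ K : ℝ, ∀ i j, ‖F i (b j)‖ ≤ K := by
  choose C hC using hb
  -- Pulling the functionals back to the Banach space `ℓ¹` makes `banach_steinhaus` applicable; `b
  -- j` is the image of a unit vector of norm one.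
  let S : lp (fun _ : ℕ => ℂ) 1 →L[ℂ] 𝓢(E, ℂ) := ⟨schwartzSeries hC, continuous_schwartzSeries hC⟩
  obtain ⟨K, hK⟩ := banach_steinhaus (g := fun i => (F i).comp S) fun c => hF (S c)
  refine ⟨K, fun i j => ?_⟩
  have h := ((F i).comp S).le_of_opNorm_le (hK i) (lp.single 1 j 1)
  rw [lp.norm_single (by norm_num), norm_one, mul_one] at h
  have e : S (lp.single 1 j 1) = b j := schwartzSeries_single hC j
  rwa [ContinuousLinearMap.comp_apply, e] at h

end UniformBoundedness

/-! ### Schwartz seminorms of `f^j φ` where `|f| ≤ ρ < 1`. -/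

section PowerBounds

variable {E : Type*} [NormedAddCommGroup E] [NormedSpace ℝ E]

/-- Differentiating `y^j` costs at most `j^l`, which the geometric decay `ρ^j` absorbs; hence one
constant serves all `j`. -/
lemma exists_norm_iteratedFDeriv_pow_le (l : ℕ) {ρ : ℝ} (hρ0 : 0 < ρ) (hρ : ρ < 1) :
    ∃ C : ℝ, 0 ≤ C ∧ ∀ (j : ℕ) (x : ℝ), |x| ≤ ρ →
      ‖iteratedFDeriv ℝ l (fun y : ℝ => y ^ j) x‖ ≤ C := by
  have ht := tendsto_pow_const_mul_const_pow_of_lt_one l hρ0.le hρ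
  obtain ⟨C, hC⟩ := ht.bddAbove_range
  have hC0 : 0 ≤ C := le_trans (by positivity) (hC ⟨1, rfl⟩)
  refine ⟨C / ρ ^ l, by positivity, fun j x hx => ?_⟩
  rw [norm_iteratedFDeriv_eq_norm_iteratedDeriv, show iteratedDeriv l (fun y : ℝ => y ^ j) x =
      (j.descFactorial l : ℝ) * x ^ (j - l) by simp,
    norm_mul, norm_pow, Real.norm_eq_abs x]
  rcases lt_or_ge j l with hjl | hjl
  · rw [Nat.descFactorial_eq_zero_iff_lt.2 hjl]
    simp only [CharP.cast_eq_zero, norm_zero, zero_mul]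
    positivity
  · rw [le_div_iff₀ (by positivity), Real.norm_natCast]
    calc (j.descFactorial l : ℝ) * |x| ^ (j - l) * ρ ^ l
        ≤ (j : ℝ) ^ l * ρ ^ (j - l) * ρ ^ l := by
          gcongr
          exact_mod_cast Nat.descFactorial_le_pow j l
      _ = (j : ℝ) ^ l * ρ ^ j := by rw [mul_assoc, ← pow_add, Nat.sub_add_cancel hjl]
      _ ≤ C := hC ⟨j, rfl⟩

/-- The derivatives of the powers of `f` are bounded on compact subsets of `{|f| ≤ ρ}`, `ρ < 1`. -/
lemma exists_norm_iteratedFDeriv_comp_pow_le {f : E → ℝ} (hf : ContDiff ℝ ∞ f) {K : Set E}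
    (hK : IsCompact K) {ρ : ℝ} (hρ0 : 0 < ρ) (hρ : ρ < 1) (hfK : ∀ x ∈ K, |f x| ≤ ρ) (l : ℕ) :
    ∃ C : ℝ, 0 ≤ C ∧ ∀ (j : ℕ), ∀ x ∈ K, ‖iteratedFDeriv ℝ l (fun y => f y ^ j) x‖ ≤ C := by
  choose G hG0 hG using fun l => exists_norm_iteratedFDeriv_pow_le l hρ0 hρ
  have hD : ∀ i : ℕ, ∃ D : ℝ, ∀ x ∈ K, ‖iteratedFDeriv ℝ i f x‖ ≤ D := fun i =>
    hK.exists_bound_of_continuousOn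
      (hf.continuous_iteratedFDeriv (m := i) (by exact_mod_cast le_top)).continuousOn
  choose D hD using hD
  set A := ∑ i ∈ Finset.range (l + 1), G i with hA
  -- The bound for derivatives of a composition asks for `‖D^i f‖ ≤ B^i`; with `B ≥ 1` it is enough
  -- that `B` dominates each `D i`.
  set B := 1 + ∑ i ∈ Finset.range (l + 1), |D i| with hB
  have hA0 : 0 ≤ A := Finset.sum_nonneg fun i _ => hG0 i
  have hB1 : 1 ≤ B := le_add_of_nonneg_right (Finset.sum_nonneg fun i _ => abs_nonneg _)
  refine ⟨l.factorial * A * B ^ l, by positivity, fun j x hx => ?_⟩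
  refine norm_iteratedFDeriv_comp_le (g := fun y : ℝ => y ^ j) (N := ∞) (contDiff_id.pow j) hf
    (by exact_mod_cast le_top) x (fun i hi => ?_) (fun i hi1 hi => ?_)
  · exact (hG i j _ (hfK x hx)).trans
      (Finset.single_le_sum (f := G) (fun i _ => hG0 i) (Finset.mem_range.2 (by omega)))
  · refine le_trans ?_ (le_self_pow₀ hB1 (by omega))
    refine ((hD i x hx).trans (le_abs_self _)).trans ?_
    refine (Finset.single_le_sum (f := fun i => |D i|) (fun i _ => abs_nonneg _)
      (Finset.mem_range.2 (show i < l + 1 by omega))).trans ?_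
    rw [hB]; linarith

/-- By the Leibniz rule, each term pairs a derivative of `f^j`, bounded on `K` uniformly in `j`,
with a derivative of `φ`, which vanishes off `K`. -/
lemma exists_seminorm_pow_smul_le {f : E → ℝ} (hf : ContDiff ℝ ∞ f) {K : Set E}
    (hK : IsCompact K) {ρ : ℝ} (hρ0 : 0 < ρ) (hρ : ρ < 1) (hfK : ∀ x ∈ K, |f x| ≤ ρ)
    (φ : 𝓢(E, ℂ)) (hφ : tsupport φ ⊆ K) (b : ℕ → 𝓢(E, ℂ)) (hb : ∀ j x, b j x = f x ^ j • φ x)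
    (k l : ℕ) : ∃ C : ℝ, ∀ j, SchwartzMap.seminorm ℂ k l (b j) ≤ C := by
  choose G hG0 hG using exists_norm_iteratedFDeriv_comp_pow_le hf hK hρ0 hρ hfK
  set C := ∑ i ∈ Finset.range (l + 1),
    (l.choose i : ℝ) * G i * SchwartzMap.seminorm ℂ k (l - i) φ with hC
  have hC0 : 0 ≤ C := Finset.sum_nonneg fun i _ => by have := hG0 i; positivity
  refine ⟨C, fun j => SchwartzMap.seminorm_le_bound ℂ k l _ hC0 fun x => ?_⟩
  have e : (b j : E → ℂ) = fun x => f x ^ j • φ x := funext (hb j)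
  rw [e]
  have h := norm_iteratedFDeriv_smul_le (N := ∞) (hf.pow j) (φ.smooth ⊤) x (n := l)
    (by exact_mod_cast le_top)
  refine (mul_le_mul_of_nonneg_left h (by positivity)).trans ?_
  rw [Finset.mul_sum]
  refine Finset.sum_le_sum fun i _ => ?_
  by_cases hx : x ∈ tsupport φ
  · calc _ = (l.choose i : ℝ) * ‖iteratedFDeriv ℝ i (fun y => f y ^ j) x‖
          * (‖x‖ ^ k * ‖iteratedFDeriv ℝ (l - i) φ x‖) := by ring
      _ ≤ _ := by
        have := hG0 i
        gcongr
        · exact hG i j x (hφ hx)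
        · exact SchwartzMap.le_seminorm ℂ k (l - i) φ x
  · have h0 : iteratedFDeriv ℝ (l - i) φ x = 0 :=
      Function.notMem_support.1 fun h => hx (support_iteratedFDeriv_subset (l - i) h)
    have := hG0 i
    rw [h0, norm_zero, mul_zero, mul_zero]
    positivity

end PowerBounds

/-! ### Uniqueness for the hierarchy, and the exponential flow. -/

section LinearHierarchy

variable {V : Type*} [NormedAddCommGroup V] [NormedSpace ℂ V] [CompleteSpace V]

/-- Uniqueness for a bounded infinite hierarchy of linear equations with zero initial data. -/
lemma eq_zero_of_hierarchy (A₀ A₁ : V →L[ℂ] V) (X : ℕ → ℝ → V) {T : ℝ} (hT : 0 ≤ T)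
    (hc : ∀ j, ContinuousOn (X j) (Icc 0 T))
    (hd : ∀ j, ∀ t ∈ Ioo 0 T, HasDerivAt (X j) (A₀ (X j t) + A₁ (X (j + 1) t)) t)
    (h0 : ∀ j, X j 0 = 0) (K : ℝ) (hK : ∀ j, ∀ t ∈ Icc 0 T, ‖X j t‖ ≤ K) (j : ℕ) :
    X j T = 0 := by
  set c := ‖A₀‖ + ‖A₁‖ with hcdef
  -- Each integration in time gains a factor `c t / (k + 1)`. Quantifying over all `j` inside the
  -- induction lets the bound for level `j + 1` be used at level `j`.
  have key : ∀ k : ℕ, ∀ j, ∀ t ∈ Icc 0 T, ‖X j t‖ ≤ K * ((c * t) ^ k / k.factorial) := by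
    intro k
    induction k with
    | zero => simpa using hK
    | succ k ih =>
      intro j t ht
      have hsub : Icc 0 t ⊆ Icc 0 T := Icc_subset_Icc_right ht.2
      have hcont : ContinuousOn (fun s => A₀ (X j s) + A₁ (X (j + 1) s)) (Icc 0 t) :=
        (A₀.continuous.comp_continuousOn ((hc j).mono hsub)).add
          (A₁.continuous.comp_continuousOn ((hc (j + 1)).mono hsub))
      have hI := intervalIntegral.integral_eq_sub_of_hasDerivAt_of_le ht.1 ((hc j).mono hsub)
        (fun s hs => hd j s ⟨hs.1, hs.2.trans_le ht.2⟩)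
        (hcont.intervalIntegrable_of_Icc ht.1)
      rw [h0, sub_zero] at hI
      rw [← hI]
      have hb : ∀ s ∈ Icc 0 t, ‖A₀ (X j s) + A₁ (X (j + 1) s)‖
          ≤ (K * c ^ (k + 1) / k.factorial) * s ^ k := by
        intro s hs
        have h1 := (A₀.le_opNorm (X j s)).trans
          (mul_le_mul_of_nonneg_left (ih j s (hsub hs)) (norm_nonneg _))
        have h2 := (A₁.le_opNorm (X (j + 1) s)).trans
          (mul_le_mul_of_nonneg_left (ih (j + 1) s (hsub hs)) (norm_nonneg _))
        refine (norm_add_le _ _).trans ((add_le_add h1 h2).trans (le_of_eq ?_))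
        rw [← add_mul, ← hcdef, mul_pow, pow_succ]
        ring
      refine (intervalIntegral.norm_integral_le_of_norm_le ht.1
        (Eventually.of_forall fun s hs => hb s (Ioc_subset_Icc_self hs))
        (Continuous.intervalIntegrable (by fun_prop) _ _)).trans (le_of_eq ?_)
      rw [intervalIntegral.integral_const_mul, integral_pow, Nat.factorial_succ]
      push_cast
      have : (k.factorial : ℝ) ≠ 0 := by positivity
      have : (k + 1 : ℝ) ≠ 0 := by positivity
      field_simp
      ring_nf
  have hlim := (FloorSemiring.tendsto_pow_div_factorial_atTop (c * T)).const_mul K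
  rw [mul_zero] at hlim
  exact norm_le_zero_iff.1
    (ge_of_tendsto' hlim fun k => key k j T ⟨hT, le_rfl⟩)

/-- The propagator `exp (t (A₀ + q A₁))`. -/
def propagator (A₀ A₁ : V →L[ℂ] V) (q t : ℝ) : V →L[ℂ] V :=
  NormedSpace.exp (t • (A₀ + (q : ℂ) • A₁))

lemma continuous_propagator (A₀ A₁ : V →L[ℂ] V) :
    Continuous fun p : ℝ × ℝ => propagator A₀ A₁ p.1 p.2 := by
  let _ : NormedAlgebra ℚ (V →L[ℂ] V) := NormedAlgebra.restrictScalars ℚ ℂ (V →L[ℂ] V)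
  unfold propagator
  exact NormedSpace.exp_continuous.comp (by fun_prop)

lemma exists_norm_propagator_le (A₀ A₁ : V →L[ℂ] V) (T : ℝ) :
    ∃ K : ℝ, 0 ≤ K ∧ ∀ q ∈ Icc (0 : ℝ) 1, ∀ t ∈ Icc (-T) T, ‖propagator A₀ A₁ q t‖ ≤ K := by
  obtain ⟨K, hK⟩ := (isCompact_Icc.prod isCompact_Icc).exists_bound_of_continuousOn
    (s := Icc (0 : ℝ) 1 ×ˢ Icc (-T) T) (continuous_propagator A₀ A₁).continuousOn
  exact ⟨max K 0, le_max_right _ _, fun q hq t ht => (hK (q, t) ⟨hq, ht⟩).trans (le_max_left _ _)⟩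

lemma norm_generator_le (A₀ A₁ : V →L[ℂ] V) {q : ℝ} (hq : |q| ≤ 1) :
    ‖A₀ + (q : ℂ) • A₁‖ ≤ ‖A₀‖ + ‖A₁‖ := by
  refine (norm_add_le _ _).trans (add_le_add_right ?_ _)
  rw [norm_smul, Complex.norm_real]
  exact mul_le_of_le_one_left (norm_nonneg _) hq

lemma hasDerivAt_propagator (A₀ A₁ : V →L[ℂ] V) (q t : ℝ) :
    HasDerivAt (propagator A₀ A₁ q)
      ((A₀ + (q : ℂ) • A₁) * propagator A₀ A₁ q t) t := by
  unfold propagator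
  exact hasDerivAt_exp_smul_const' (𝕂 := ℝ) (A₀ + (q : ℂ) • A₁) t

lemma propagator_zero (A₀ A₁ : V →L[ℂ] V) (q : ℝ) : propagator A₀ A₁ q 0 = 1 := by
  simp [propagator]

lemma hasDerivAt_clm_apply_const {P : ℝ → V →L[ℂ] V} {P' : V →L[ℂ] V} {s : ℝ}
    (h : HasDerivAt P P' s) (x : V) : HasDerivAt (fun s => P s x) (P' x) s :=
  (((ContinuousLinearMap.apply ℂ V x).restrictScalars ℝ).hasFDerivAt.comp_hasDerivAt s h :)

/-- The function `exp(-λ s) • propagator s x` has zero derivative, provided the derivative of the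
exponential is written with the generator on the right, where it meets `x`. -/
lemma propagator_apply_eigenvector (A₀ A₁ : V →L[ℂ] V) (q t : ℝ) (lam : ℂ) (x : V)
    (hx : A₀ x + (q : ℂ) • A₁ x = lam • x) :
    propagator A₀ A₁ q t x = Complex.exp (lam * t) • x := by
  have hP (s : ℝ) : HasDerivAt (fun s => propagator A₀ A₁ q s x)
      (lam • propagator A₀ A₁ q s x) s := by
    have h : HasDerivAt (propagator A₀ A₁ q)
        (propagator A₀ A₁ q s * (A₀ + (q : ℂ) • A₁)) s :=
      hasDerivAt_exp_smul_const (𝕂 := ℝ) (A₀ + (q : ℂ) • A₁) s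
    refine (hasDerivAt_clm_apply_const h x).congr_deriv ?_
    rw [mul_apply_eq_comp, add_apply, smul_apply, hx, map_smul]
  have hE (s : ℝ) : HasDerivAt (fun s : ℝ => Complex.exp (-(lam * s)))
      (Complex.exp (-(lam * s)) * -(lam * 1)) s :=
    (((Complex.ofRealCLM.hasDerivAt (x := s)).const_mul lam).neg).cexp
  have hf (s : ℝ) : HasDerivAt
      (fun s : ℝ => Complex.exp (-(lam * s)) • propagator A₀ A₁ q s x) 0 s := by
    refine ((hE s).smul (hP s)).congr_deriv ?_
    rw [smul_smul, ← add_smul]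
    ring_nf
    simp
  have hconst := is_const_of_deriv_eq_zero (fun s => (hf s).differentiableAt)
    (fun s => (hf s).deriv) t 0
  simp only [Complex.ofReal_zero, mul_zero, neg_zero, Complex.exp_zero, one_smul,
    propagator_zero, one_apply_eq_self] at hconst
  calc _ = Complex.exp (lam * t) • Complex.exp (-(lam * t)) • propagator A₀ A₁ q t x := by
        rw [smul_smul, ← Complex.exp_add]; simp
    _ = _ := by rw [hconst]

variable {n : ℕ}

lemma integrable_smul_propagator (A₀ A₁ : V →L[ℂ] V) {q : Rn n → ℝ} (hq : Continuous q)
    {φ : Rn n → ℂ} (hφc : Continuous φ) (hφ : Integrable φ)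
    (hφq : ∀ ξ, φ ξ ≠ 0 → q ξ ∈ Icc (0 : ℝ) 1) {x₀ : Rn n → V} (hx : Continuous x₀) {N : ℝ}
    (hN : ∀ ξ, ‖x₀ ξ‖ ≤ N) (t : ℝ) :
    Integrable fun ξ => φ ξ • propagator A₀ A₁ (q ξ) t (x₀ ξ) := by
  obtain ⟨K, hK0, hK⟩ := exists_norm_propagator_le A₀ A₁ |t|
  have hP := (continuous_propagator A₀ A₁).comp (hq.prodMk (continuous_const (y := t)))
  refine (hφ.norm.mul_const (K * N)).mono' (hφc.smul (hP.clm_apply hx)).aestronglyMeasurable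
    (Eventually.of_forall fun ξ => ?_)
  rw [norm_smul]
  by_cases h : φ ξ = 0
  · simp [h]
  · exact mul_le_mul_of_nonneg_left (ContinuousLinearMap.le_of_opNorm_le_of_le _
      (hK _ (hφq ξ h) t ⟨neg_abs_le t, le_abs_self t⟩) (hN ξ)) (norm_nonneg _)

lemma exists_norm_integral_propagator_le (A₀ A₁ : V →L[ℂ] V) {q : Rn n → ℝ} {x₀ : Rn n → V}
    {N : ℝ} (hN : ∀ ξ, ‖x₀ ξ‖ ≤ N) (T : ℝ) :
    ∃ K : ℝ, 0 ≤ K ∧ ∀ φ : Rn n → ℂ, Integrable φ → (∀ ξ, φ ξ ≠ 0 → q ξ ∈ Icc (0 : ℝ) 1) →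
      ∀ t ∈ Icc 0 T, ‖∫ ξ, φ ξ • propagator A₀ A₁ (q ξ) t (x₀ ξ)‖ ≤ K * ∫ ξ, ‖φ ξ‖ := by
  obtain ⟨K, hK0, hK⟩ := exists_norm_propagator_le A₀ A₁ T
  have hN0 : 0 ≤ N := (norm_nonneg _).trans (hN 0)
  refine ⟨K * N, by positivity, fun φ hφ hφq t ht => ?_⟩
  rw [← integral_const_mul]
  refine norm_integral_le_of_norm_le (hφ.norm.const_mul _) (Eventually.of_forall fun ξ => ?_)
  rw [norm_smul, mul_comm]
  by_cases h : φ ξ = 0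
  · simp [h]
  · exact mul_le_mul_of_nonneg_right (ContinuousLinearMap.le_of_opNorm_le_of_le _
      (hK _ (hφq ξ h) t ⟨by linarith [ht.1, ht.2], ht.2⟩) (hN ξ)) (norm_nonneg _)

/-- The factor `q` of the generator is moved onto the weight `φ`, so the explicit flow satisfies the
same hierarchy as the distributional solution. Having `q ∈ [0, 1]` wherever `φ ≠ 0` supplies the
dominating function. -/
lemma hasDerivAt_integral_propagator (A₀ A₁ : V →L[ℂ] V) {q : Rn n → ℝ} (hq : Continuous q)
    {φ : Rn n → ℂ} (hφc : Continuous φ) (hφ : Integrable φ)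
    (hφq : ∀ ξ, φ ξ ≠ 0 → q ξ ∈ Icc (0 : ℝ) 1) {x₀ : Rn n → V} (hx : Continuous x₀) {N : ℝ}
    (hN : ∀ ξ, ‖x₀ ξ‖ ≤ N) (t : ℝ) :
    HasDerivAt (fun t => ∫ ξ, φ ξ • propagator A₀ A₁ (q ξ) t (x₀ ξ))
      (A₀ (∫ ξ, φ ξ • propagator A₀ A₁ (q ξ) t (x₀ ξ))
        + A₁ (∫ ξ, (q ξ * φ ξ : ℂ) • propagator A₀ A₁ (q ξ) t (x₀ ξ))) t := by
  have hint := integrable_smul_propagator A₀ A₁ hq hφc hφ hφq hx hN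
  have hqφ : Integrable fun ξ => (q ξ * φ ξ : ℂ) := by
    refine hφ.norm.mono' (by fun_prop) (Eventually.of_forall fun ξ => ?_)
    rw [norm_mul, Complex.norm_real]
    by_cases h : φ ξ = 0
    · simp [h]
    · rw [Real.norm_of_nonneg (hφq ξ h).1]
      exact mul_le_of_le_one_left (norm_nonneg _) (hφq ξ h).2
  have hint1 := integrable_smul_propagator A₀ A₁ hq (φ := fun ξ => (q ξ * φ ξ : ℂ))
    (by fun_prop) hqφ (fun ξ h => hφq ξ (right_ne_zero_of_mul h)) hx hN
  obtain ⟨K, hK0, hK⟩ := exists_norm_propagator_le A₀ A₁ (|t| + 1)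
  have hbd : ∀ ξ, ∀ s ∈ Metric.ball t 1,
      ‖φ ξ • ((A₀ + (q ξ : ℂ) • A₁) * propagator A₀ A₁ (q ξ) s) (x₀ ξ)‖
        ≤ ‖φ ξ‖ * ((‖A₀‖ + ‖A₁‖) * K * N) := by
    intro ξ s hs
    rw [norm_smul]
    by_cases h : φ ξ = 0
    · simp [h]
    have hs' : |s| ≤ |t| + 1 := by
      have h1 : |s - t| < 1 := by simpa [Real.dist_eq] using hs
      have := abs_sub_abs_le_abs_sub s t
      linarith
    refine mul_le_mul_of_nonneg_left (ContinuousLinearMap.le_of_opNorm_le_of_le _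
      ((norm_mul_le _ _).trans (mul_le_mul ?_ (hK _ (hφq ξ h) s (abs_le.1 hs'))
        (norm_nonneg _) (by positivity))) (hN ξ)) (norm_nonneg _)
    exact norm_generator_le A₀ A₁ (abs_le.2 ⟨by linarith [(hφq ξ h).1], (hφq ξ h).2⟩)
  have hcP : Continuous fun ξ => propagator A₀ A₁ (q ξ) t :=
    (continuous_propagator A₀ A₁).comp (hq.prodMk (continuous_const (y := t)))
  have h := (hasDerivAt_integral_of_dominated_loc_of_deriv_le (μ := volume)
    (F := fun t ξ => φ ξ • propagator A₀ A₁ (q ξ) t (x₀ ξ))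
    (F' := fun t ξ => φ ξ • ((A₀ + (q ξ : ℂ) • A₁) * propagator A₀ A₁ (q ξ) t) (x₀ ξ))
    (Metric.ball_mem_nhds t one_pos)
    (Eventually.of_forall fun s => (hint s).aestronglyMeasurable) (hint t)
    (Continuous.aestronglyMeasurable (by fun_prop))
    (Eventually.of_forall hbd) (hφ.norm.mul_const _)
    (Eventually.of_forall fun ξ s _ => (hasDerivAt_clm_apply_const
      (hasDerivAt_propagator A₀ A₁ (q ξ) s) (x₀ ξ)).const_smul (φ ξ))).2
  refine h.congr_deriv ?_
  rw [← A₀.integral_comp_comm (hint t), ← A₁.integral_comp_comm (hint1 t),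
    ← integral_add (A₀.integrable_comp (hint t)) (A₁.integrable_comp (hint1 t))]
  congr 1 with ξ
  simp only [mul_apply_eq_comp, add_apply, smul_apply, map_smul, smul_add, smul_smul]
  rw [mul_comm (φ ξ)]

end LinearHierarchy

/-! ### The memory term as a state variable. -/

section Memory

/-- The memory term `∫₀ᵗ e^{-γ(t-η)} y(η) dη` of a function on `[0, ∞)`. -/
def memory (γ : ℝ) (y : ℝ → ℂ) (t : ℝ) : ℂ :=
  (Real.exp (-γ * t) : ℂ) * ∫ η in (0 : ℝ)..t, (Real.exp (γ * η) : ℂ) * y (max η 0)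

lemma integral_relaxation_eq_memory (γ : ℝ) (y : ℝ → ℂ) {t : ℝ} (ht : 0 ≤ t) :
    ∫ η in (0 : ℝ)..t, (relaxation γ (t - η) : ℂ) * y η = memory γ y t := by
  rw [memory, ← intervalIntegral.integral_const_mul]
  refine intervalIntegral.integral_congr fun η hη => ?_
  rw [uIcc_of_le ht] at hη
  simp only [max_eq_left hη.1, relaxation]
  rw [← mul_assoc, ← Complex.ofReal_mul, ← Real.exp_add]
  ring_nf

lemma memory_zero (γ : ℝ) (y : ℝ → ℂ) : memory γ y 0 = 0 := by simp [memory]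

/-- The kernel factors as `e^{-γt} e^{γη}`, so the parameter leaves the integral and the product
rule gives an ordinary differential equation. Freezing `y` at `y 0` for negative times makes the
integrand continuous on `ℝ`, so the derivative exists also at `t = 0`. -/
lemma hasDerivAt_memory (γ : ℝ) {y : ℝ → ℂ} (hy : ContinuousOn y (Ici 0)) (t : ℝ) :
    HasDerivAt (memory γ y) (y (max t 0) - γ * memory γ y t) t := by
  have hc : Continuous fun η : ℝ => (Real.exp (γ * η) : ℂ) * y (max η 0) := by
    refine Continuous.mul (by fun_prop) ?_
    exact hy.comp_continuous (by fun_prop) fun η => mem_Ici.2 (le_max_right _ _)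
  have h1 := intervalIntegral.integral_hasDerivAt_right (hc.intervalIntegrable 0 t)
    (hc.stronglyMeasurableAtFilter _ _) hc.continuousAt
  have h2 : HasDerivAt (fun t : ℝ => (Real.exp (-γ * t) : ℂ))
      ((Real.exp (-γ * t) * (-γ * 1) : ℝ) : ℂ) t :=
    (((hasDerivAt_id t).const_mul (-γ)).exp).ofReal_comp
  refine (h2.mul h1).congr_deriv ?_
  have e : (Real.exp (-γ * t) : ℂ) * (Real.exp (γ * t) : ℂ) = 1 := by
    rw [← Complex.ofReal_mul, ← Real.exp_add]; simp
  rw [memory]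
  simp only [Complex.ofReal_mul, Complex.ofReal_neg, Complex.ofReal_one]
  linear_combination y (max t 0) * e

lemma norm_memory_le {γ : ℝ} (hγ : 0 ≤ γ) {y : ℝ → ℂ} {T K : ℝ}
    (hK : ∀ t ∈ Icc 0 T, ‖y t‖ ≤ K) {t : ℝ} (ht : t ∈ Icc 0 T) : ‖memory γ y t‖ ≤ K * T := by
  have hK0 : 0 ≤ K := (norm_nonneg _).trans (hK t ht)
  rw [← integral_relaxation_eq_memory γ y ht.1]
  refine (intervalIntegral.norm_integral_le_of_norm_le_const (C := K) fun η hη => ?_).trans ?_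
  · rw [uIoc_of_le ht.1] at hη
    rw [norm_mul, Complex.norm_real, relaxation, Real.norm_of_nonneg (Real.exp_pos _).le]
    have h1 : Real.exp (-γ * (t - η)) ≤ 1 :=
      Real.exp_le_one_iff.2 (by nlinarith [hη.2])
    have h2 := hK η ⟨hη.1.le, hη.2.trans ht.2⟩
    nlinarith [norm_nonneg (y η), Real.exp_pos (-γ * (t - η))]
  · rw [sub_zero, abs_of_nonneg ht.1]
    exact mul_le_mul_of_nonneg_left ht.2 hK0

end Memory

/-! ### The system on the Fourier side. -/

section Symbol

/-- The part of the generator of the system for `(u, u_t, g ∗ u)` independent of the frequency. -/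
def generatorConst (γ : ℝ) : (ℂ × ℂ × ℂ) →L[ℂ] (ℂ × ℂ × ℂ) :=
  ((ContinuousLinearMap.fst ℂ ℂ ℂ).comp (ContinuousLinearMap.snd ℂ ℂ (ℂ × ℂ))).prod
    ((0 : (ℂ × ℂ × ℂ) →L[ℂ] ℂ).prod
      (ContinuousLinearMap.fst ℂ ℂ (ℂ × ℂ) - (γ : ℂ) •
        ((ContinuousLinearMap.snd ℂ ℂ ℂ).comp (ContinuousLinearMap.snd ℂ ℂ (ℂ × ℂ)))))

/-- The part of the generator proportional to `|ξ|²`. -/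
def generatorSq : (ℂ × ℂ × ℂ) →L[ℂ] (ℂ × ℂ × ℂ) :=
  (0 : (ℂ × ℂ × ℂ) →L[ℂ] ℂ).prod
    ((-ContinuousLinearMap.fst ℂ ℂ (ℂ × ℂ)
      - (ContinuousLinearMap.fst ℂ ℂ ℂ).comp (ContinuousLinearMap.snd ℂ ℂ (ℂ × ℂ))
      + (ContinuousLinearMap.snd ℂ ℂ ℂ).comp (ContinuousLinearMap.snd ℂ ℂ (ℂ × ℂ))).prod 0)

@[simp] lemma generatorConst_apply (γ : ℝ) (x : ℂ × ℂ × ℂ) :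
    generatorConst γ x = (x.2.1, 0, x.1 - γ * x.2.2) := rfl

@[simp] lemma generatorSq_apply (x : ℂ × ℂ × ℂ) :
    generatorSq x = (0, -x.1 - x.2.1 + x.2.2, 0) := rfl

/-- The Fourier side solution operator at squared frequency `q`. -/
def solutionFlow (γ q t : ℝ) : (ℂ × ℂ × ℂ) →L[ℂ] (ℂ × ℂ × ℂ) :=
  propagator (generatorConst γ) generatorSq q t

variable {n : ℕ}

/-- The square of the angular frequency. -/
def freqSq (ξ : Rn n) : ℝ := (2 * Real.pi * ‖ξ‖) ^ 2

lemma contDiff_freqSq : ContDiff ℝ ∞ (freqSq (n := n)) := by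
  unfold freqSq
  simp_rw [mul_pow _ ‖_‖]
  exact contDiff_const.mul (contDiff_norm_sq ℝ)

lemma continuous_freqSq : Continuous (freqSq (n := n)) := contDiff_freqSq.continuous

lemma hasTemperateGrowth_freqSq : (freqSq (n := n)).HasTemperateGrowth := by
  unfold freqSq
  simp_rw [mul_pow _ ‖_‖]
  fun_prop

/-- The spatial Fourier transform of the solution of the Cauchy problem. -/
def solutionSymbol (γ : ℝ) (u₀ u₁ : Rn n → ℂ) (t : ℝ) (ξ : Rn n) : ℂ :=
  (solutionFlow γ (freqSq ξ) t (𝓕 u₀ ξ, 𝓕 u₁ ξ, 0)).1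

/-- This raises the level of the hierarchy: the Laplacian acting on `w` turns into one more factor
`freqSq` on the test function. -/
lemma laplacian_apply_fourier (w : 𝓢'(Rn n, ℂ)) (φ : 𝓢(Rn n, ℂ)) :
    (Δ w) (𝓕 φ) = -w (𝓕 (SchwartzMap.smulLeftCLM ℂ (freqSq (n := n)) φ)) := by
  have e : SchwartzMap.smulLeftCLM ℂ (freqSq (n := n)) φ = ((2 * Real.pi) ^ 2 : ℂ) •
      SchwartzMap.smulLeftCLM ℂ (fun x : Rn n => Complex.ofReal (‖x‖ ^ 2)) φ := by
    ext ξ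
    rw [SchwartzMap.smulLeftCLM_apply_apply hasTemperateGrowth_freqSq, smul_apply,
      SchwartzMap.smulLeftCLM_apply_apply (by fun_prop), freqSq, mul_pow, Complex.real_smul]
    push_cast
    simp [mul_assoc]
  rw [TemperedDistribution.laplacian_eq_fourierMultiplierCLM, e, FourierTransform.fourier_smul,
    map_smul]
  have h := TemperedDistribution.fourierMultiplierCLM_apply_apply
    (fun x : Rn n => Complex.ofReal (‖x‖ ^ 2)) w (𝓕 φ)
  rw [FourierTransform.fourierInv_fourier_eq] at h
  rw [← h]
  rw [smul_apply, Complex.real_smul, smul_eq_mul]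
  push_cast
  ring

lemma norm_fourier_le_integral (f : Rn n → ℂ) (ξ : Rn n) : ‖𝓕 f ξ‖ ≤ ∫ x, ‖f x‖ :=
  VectorFourier.norm_fourierIntegral_le_integral_norm _ _ _ _ _

lemma continuous_fourier_of_integrable {f : Rn n → ℂ} (hf : Integrable f) :
    Continuous (𝓕 f) :=
  VectorFourier.fourierIntegral_continuous Real.continuous_fourierChar continuous_inner hf

lemma integral_fourier_mul_eq_flip (φ : 𝓢(Rn n, ℂ)) {f : Rn n → ℂ} (hf : Integrable f) :
    ∫ x, (𝓕 φ) x * f x = ∫ ξ, φ ξ * 𝓕 f ξ := by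
  have h := VectorFourier.integral_fourierIntegral_smul_eq_flip (L := innerₗ (Rn n))
    (μ := volume) (ν := volume) Real.continuous_fourierChar continuous_inner φ.integrable hf
  rw [flip_innerₗ] at h
  simp only [smul_eq_mul] at h
  exact h

/-- Since `|e^{-i x·ξ} - 1| ≤ |x| |ξ|`, the first moment pays for one factor of the angular
frequency. This is the only use of the weight in `L^{1,1}`. -/
lemma norm_fourier_sub_integral_le {f : Rn n → ℂ} (hf : MemL11 f) (ξ : Rn n) :
    ‖𝓕 f ξ - ∫ x, f x‖ ≤ 2 * Real.pi * ‖ξ‖ * normL11 f := by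
  have hint : Integrable fun x => Real.fourierChar (-inner ℝ x ξ) • f x :=
    (Real.fourierIntegral_convergent_iff ξ).2 hf.1
  rw [Real.fourier_eq, ← integral_sub hint hf.1, normL11, ← integral_const_mul]
  refine norm_integral_le_of_norm_le (hf.2.const_mul _) (Eventually.of_forall fun x => ?_)
  have e : Real.fourierChar (-inner ℝ x ξ) • f x - f x =
      (Complex.exp (Complex.I * (2 * Real.pi * -inner ℝ x ξ : ℝ)) - 1) * f x := by
    rw [Circle.smul_def, Real.fourierChar_apply, smul_eq_mul, sub_mul, one_mul]
    congr 3
    rw [mul_comm]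
  rw [e, norm_mul]
  have h1 := Real.norm_exp_I_mul_ofReal_sub_one_le (x := 2 * Real.pi * -inner ℝ x ξ)
  have h2 : ‖2 * Real.pi * -inner ℝ x ξ‖ ≤ 2 * Real.pi * ‖ξ‖ * (1 + ‖x‖) := by
    have hpi : (0 : ℝ) ≤ 2 * Real.pi := by positivity
    rw [norm_mul, norm_neg, Real.norm_of_nonneg hpi, mul_assoc (2 * Real.pi) ‖ξ‖]
    refine mul_le_mul_of_nonneg_left ?_ hpi
    refine (norm_inner_le_norm x ξ).trans ?_
    nlinarith [norm_nonneg ξ, norm_nonneg x]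
  rw [← mul_assoc]
  exact mul_le_mul_of_nonneg_right (h1.trans h2) (norm_nonneg _)

lemma integral_norm_le_normL11 {f : Rn n → ℂ} (hf : MemL11 f) : ∫ x, ‖f x‖ ≤ normL11 f := by
  refine integral_mono hf.1.norm hf.2 fun x => ?_
  nlinarith [norm_nonneg (f x), norm_nonneg x, mul_nonneg (norm_nonneg x) (norm_nonneg (f x))]

end Symbol

/-! ### Identification of solutions at low frequencies. -/

section Representation

variable {n : ℕ} {γ : ℝ} {u₀ u₁ : Rn n → ℂ} {u : ℝ → 𝓢'(Rn n, ℂ)}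

/-- The functional `φ ↦ w (𝓕 φ)`. -/
def fourierFunctional (w : 𝓢'(Rn n, ℂ)) : 𝓢(Rn n, ℂ) →L[ℂ] ℂ where
  toFun φ := w (𝓕 φ)
  map_add' φ ψ := by rw [FourierTransform.fourier_add, map_add]
  map_smul' c φ := by rw [FourierTransform.fourier_smul, map_smul]; rfl
  cont := (map_continuous w).comp (FourierTransform.fourierCLM ℂ 𝓢(Rn n, ℂ)).continuous

/-- The iterated products `|ξ|^{2j} φ`. -/
def freqSqPow (φ : 𝓢(Rn n, ℂ)) (j : ℕ) : 𝓢(Rn n, ℂ) :=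
  (SchwartzMap.smulLeftCLM ℂ (freqSq (n := n)))^[j] φ

lemma freqSqPow_succ (φ : 𝓢(Rn n, ℂ)) (j : ℕ) :
    freqSqPow φ (j + 1) = SchwartzMap.smulLeftCLM ℂ (freqSq (n := n)) (freqSqPow φ j) :=
  Function.iterate_succ_apply' _ _ _

lemma freqSqPow_apply (φ : 𝓢(Rn n, ℂ)) (j : ℕ) (ξ : Rn n) :
    freqSqPow φ j ξ = freqSq ξ ^ j • φ ξ := by
  induction j with
  | zero => simp [freqSqPow]
  | succ j ih =>
    rw [freqSqPow_succ, SchwartzMap.smulLeftCLM_apply_apply hasTemperateGrowth_freqSq, ih,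
      smul_smul, pow_succ']

lemma exists_bound_on_freqSqPow {w : ℝ → 𝓢'(Rn n, ℂ)}
    (hw : ∀ φ, ContinuousOn (fun t => w t φ) (Ici 0)) {φ : 𝓢(Rn n, ℂ)}
    (hφ : tsupport φ ⊆ Metric.closedBall 0 (1 / (4 * Real.pi))) (T : ℝ) :
    ∃ K : ℝ, ∀ j, ∀ t ∈ Icc 0 T, ‖w t (𝓕 (freqSqPow φ j))‖ ≤ K := by
  -- On this ball `2π‖ξ‖ ≤ 1/2`, so `freqSq ≤ 1/4`, strictly below the critical value 1 for
  -- boundedness of the powers.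
  have hq : ∀ ξ ∈ Metric.closedBall (0 : Rn n) (1 / (4 * Real.pi)), |freqSq ξ| ≤ 1 / 4 := by
    intro ξ hξ
    rw [mem_closedBall_zero_iff, le_div_iff₀ (by positivity)] at hξ
    rw [freqSq, abs_of_nonneg (sq_nonneg _)]
    nlinarith [norm_nonneg ξ, Real.pi_pos, mul_nonneg (norm_nonneg ξ) Real.pi_pos.le]
  obtain ⟨K, hK⟩ := exists_uniform_bound_of_pointwise
    (fun t : Icc (0 : ℝ) T => fourierFunctional (w t))
    (fun ψ => by
      obtain ⟨K, hK⟩ := isCompact_Icc.exists_bound_of_continuousOn (s := Icc (0 : ℝ) T)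
        ((hw (𝓕 ψ)).mono Icc_subset_Ici_self)
      exact ⟨K, fun t => hK t t.2⟩)
    (freqSqPow φ)
    (exists_seminorm_pow_smul_le contDiff_freqSq (isCompact_closedBall _ _)
      (by norm_num) (by norm_num) hq φ hφ _ (freqSqPow_apply φ))
  exact ⟨K, fun j t ht => hK ⟨t, ht⟩ j⟩

/-- On low frequencies every solution is given by the solution symbol. -/
theorem IsSolution.apply_fourier (hγ : 1 < γ) (hu₀ : Integrable u₀) (hu₁ : Integrable u₁)
    (hu : IsSolution γ u₀ u₁ u) {φ : 𝓢(Rn n, ℂ)}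
    (hφ : tsupport φ ⊆ Metric.closedBall 0 (1 / (4 * Real.pi))) {T : ℝ} (hT : 0 ≤ T) :
    u T (𝓕 φ) = ∫ ξ, φ ξ * solutionSymbol γ u₀ u₁ T ξ := by
  obtain ⟨v, a, h⟩ := hu
  have hcu (ψ) : ContinuousOn (fun t => u t ψ) (Ici 0) :=
    fun t ht => ((h ψ).1 t ht).continuousWithinAt
  have hcv (ψ) : ContinuousOn (fun t => v t ψ) (Ici 0) := (h ψ).2.1
  set x₀ : Rn n → ℂ × ℂ × ℂ := fun ξ => (𝓕 u₀ ξ, 𝓕 u₁ ξ, 0) with hx₀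
  have hx₀c : Continuous x₀ := (continuous_fourier_of_integrable hu₀).prodMk
    ((continuous_fourier_of_integrable hu₁).prodMk continuous_const)
  have hx₀N : ∀ ξ, ‖x₀ ξ‖ ≤ (∫ x, ‖u₀ x‖) + ∫ x, ‖u₁ x‖ := by
    intro ξ
    have h0 : 0 ≤ ∫ x, ‖u₀ x‖ := integral_nonneg fun _ => norm_nonneg _
    have h1 : 0 ≤ ∫ x, ‖u₁ x‖ := integral_nonneg fun _ => norm_nonneg _
    have h2 := norm_fourier_le_integral u₀ ξ
    have h3 := norm_fourier_le_integral u₁ ξ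
    simp only [hx₀, Prod.norm_def, norm_zero]
    refine max_le (by linarith) (max_le (by linarith) (by linarith))
  set b := freqSqPow φ with hb
  have hq : ∀ j ξ, b j ξ ≠ 0 → freqSq ξ ∈ Icc (0 : ℝ) 1 := by
    intro j ξ hξ
    have : φ ξ ≠ 0 := fun h0 => hξ (by rw [hb, freqSqPow_apply, h0, smul_zero])
    have h1 := hφ (subset_tsupport φ (Function.mem_support.2 this))
    rw [mem_closedBall_zero_iff, le_div_iff₀ (by positivity)] at h1
    refine ⟨sq_nonneg _, ?_⟩
    rw [freqSq]
    nlinarith [norm_nonneg ξ, Real.pi_pos, mul_nonneg (norm_nonneg ξ) Real.pi_pos.le]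
  -- `W` is the hierarchy of the given solution and `w` that of the explicit flow; both obey the
  -- same equations with the same initial values.
  set W : ℕ → ℝ → ℂ × ℂ × ℂ := fun j t =>
    (u t (𝓕 (b j)), v t (𝓕 (b j)), memory γ (fun s => u s (𝓕 (b j))) t) with hW
  set w : ℕ → ℝ → ℂ × ℂ × ℂ := fun j t =>
    ∫ ξ, b j ξ • solutionFlow γ (freqSq ξ) t (x₀ ξ) with hw
  have hwd (j : ℕ) (t : ℝ) : HasDerivAt (w j)
      (generatorConst γ (w j t) + generatorSq (w (j + 1) t)) t := by
    refine (hasDerivAt_integral_propagator (generatorConst γ) generatorSq continuous_freqSq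
      (b j).continuous (b j).integrable (hq j) hx₀c hx₀N t).congr_deriv ?_
    have : ∀ ξ, b (j + 1) ξ = freqSq ξ * b j ξ := fun ξ => by
      rw [hb, freqSqPow_apply, freqSqPow_apply, pow_succ', mul_smul, Complex.real_smul]
    simp only [hw, this]
    rfl
  have hWd (j : ℕ) (t : ℝ) (ht : 0 < t) : HasDerivAt (W j)
      (generatorConst γ (W j t) + generatorSq (W (j + 1) t)) t := by
    have h1 : HasDerivAt (fun s => u s (𝓕 (b j))) (v t (𝓕 (b j))) t :=
      ((h (𝓕 (b j))).1 t ht.le).hasDerivAt (Ici_mem_nhds ht)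
    have h2 := (h (𝓕 (b j))).2.2.1 t ht
    have h3 := hasDerivAt_memory γ (hcu (𝓕 (b j))) t
    rw [max_eq_left ht.le] at h3
    have h4 := (h (𝓕 (b j))).2.2.2.2.2 t ht
    simp only [laplacian_apply_fourier, hb, ← freqSqPow_succ, mul_neg,
      intervalIntegral.integral_neg] at h4
    rw [integral_relaxation_eq_memory γ (fun s => u s (𝓕 (freqSqPow φ (j + 1)))) ht.le] at h4
    refine (h1.prodMk (h2.prodMk h3)).congr_deriv ?_
    simp only [hW, generatorConst_apply, generatorSq_apply, Prod.mk_add_mk, add_zero, zero_add,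
      Prod.mk.injEq, true_and, and_true]
    linear_combination h4
  have hWc (j : ℕ) : ContinuousOn (W j) (Ici 0) := by
    refine (hcu _).prodMk ((hcv _).prodMk fun t _ => ?_)
    exact (hasDerivAt_memory γ (hcu (𝓕 (b j))) t).continuousAt.continuousWithinAt
  have h0 (j : ℕ) : W j 0 = w j 0 := by
    have hint : Integrable fun ξ => b j ξ • x₀ ξ := by
      simpa [propagator_zero] using integrable_smul_propagator (generatorConst γ) generatorSq
        continuous_freqSq (b j).continuous (b j).integrable (hq j) hx₀c hx₀N 0
    have e1 := (h (𝓕 (b j))).2.2.2.1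
    have e2 := (h (𝓕 (b j))).2.2.2.2.1
    rw [integral_fourier_mul_eq_flip _ hu₀] at e1
    rw [integral_fourier_mul_eq_flip _ hu₁] at e2
    simp only [hW, hw, solutionFlow, propagator_zero, one_apply_eq_self, memory_zero, e1, e2]
    have i1 := (ContinuousLinearMap.fst ℂ ℂ (ℂ × ℂ)).integral_comp_comm hint
    have i2 := (ContinuousLinearMap.snd ℂ ℂ (ℂ × ℂ)).integral_comp_comm hint
    have i3 := (ContinuousLinearMap.fst ℂ ℂ ℂ).integral_comp_comm
      ((ContinuousLinearMap.snd ℂ ℂ (ℂ × ℂ)).integrable_comp hint)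
    have i4 := (ContinuousLinearMap.snd ℂ ℂ ℂ).integral_comp_comm
      ((ContinuousLinearMap.snd ℂ ℂ (ℂ × ℂ)).integrable_comp hint)
    rw [i2] at i3 i4
    refine Prod.ext i1 (Prod.ext i3 ?_)
    refine Eq.trans ?_ i4
    simp [hx₀]
  obtain ⟨K₁, hK₁⟩ := exists_bound_on_freqSqPow hcu hφ T
  obtain ⟨K₂, hK₂⟩ := exists_bound_on_freqSqPow hcv hφ T
  obtain ⟨K₃, hK₃0, hK₃⟩ := exists_norm_integral_propagator_le (q := freqSq) (generatorConst γ)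
    generatorSq hx₀N T
  have hbn (j : ℕ) : ∫ ξ, ‖b j ξ‖ ≤ ∫ ξ, ‖φ ξ‖ := by
    refine integral_mono (b j).integrable.norm φ.integrable.norm fun ξ => ?_
    by_cases hz : b j ξ = 0
    · simp [hz]
    · have := hq j ξ hz
      simp only [hb, freqSqPow_apply, norm_smul, norm_pow, Real.norm_of_nonneg this.1]
      exact mul_le_of_le_one_left (norm_nonneg _) (pow_le_one₀ this.1 this.2)
  have key := eq_zero_of_hierarchy (generatorConst γ) generatorSq (fun j t => W j t - w j t) hT
    (fun j => ((hWc j).mono Icc_subset_Ici_self).sub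
      fun t _ => (hwd j t).continuousAt.continuousWithinAt)
    (fun j t ht => ((hWd j t ht.1).sub (hwd j t)).congr_deriv (by
      rw [map_sub, map_sub]; abel))
    (fun j => sub_eq_zero.2 (h0 j))
    (max K₁ (max K₂ (K₁ * T)) + K₃ * ∫ ξ, ‖φ ξ‖)
    (fun j t ht => by
      refine (norm_sub_le _ _).trans (add_le_add ?_ ?_)
      · simp only [hW, Prod.norm_def]
        exact max_le_max (hK₁ j t ht) (max_le_max (hK₂ j t ht)
          (norm_memory_le (by linarith) (hK₁ j) ht))
      · exact (hK₃ _ (b j).integrable (hq j) t ht).trans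
          (mul_le_mul_of_nonneg_left (hbn j) hK₃0))
    0
  have e := congrArg Prod.fst (sub_eq_zero.1 key)
  have hint := integrable_smul_propagator (generatorConst γ) generatorSq
    continuous_freqSq (b 0).continuous (b 0).integrable (hq 0) hx₀c hx₀N T
  exact e.trans ((ContinuousLinearMap.fst ℂ ℂ (ℂ × ℂ)).integral_comp_comm hint).symm

end Representation

/-! ### Low frequency expansion of the characteristic roots. -/

section Roots

/-- The data of the characteristic roots `-ℓ`, `-s/2 ± iom` at frequency `r`, with their
low frequency expansions. -/
structure CharRoots (γ K r s om l : ℝ) : Prop where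
  omega_ge : √((γ - 1) / γ) * r / 2 ≤ om
  s_ge : r ^ 2 ≤ s
  s_le : s ≤ 3 * r ^ 2
  l_ge : γ / 2 ≤ l
  vieta_one : s + l = γ + r ^ 2
  vieta_two : s ^ 2 / 4 + om ^ 2 + s * l = (1 + γ) * r ^ 2
  vieta_three : (s ^ 2 / 4 + om ^ 2) * l = (γ - 1) * r ^ 2
  omega_sub : |om - √((γ - 1) / γ) * r| ≤ K * r ^ 3
  s_sub : |s / 2 - (γ ^ 2 + 1) / (2 * γ ^ 2) * r ^ 2| ≤ K * r ^ 4
  l_sub : |γ - l| ≤ K * r ^ 2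

/-- The cubic is the characteristic polynomial at `λ = -(γ - δ)`, so `δ` is the displacement of the
real root from `-γ`. -/
lemma exists_real_root {γ q : ℝ} (hγ : 1 < γ) (hq0 : 0 < q) (hq : q ≤ 1 / 10) :
    ∃ δ : ℝ, 0 ≤ δ ∧ δ ≤ 2 * q ∧
      -q + (γ ^ 2 + q * (1 - γ)) * δ + (q - 2 * γ) * δ ^ 2 + δ ^ 3 = 0 := by
  set f : ℝ → ℝ := fun δ =>
    -q + (γ ^ 2 + q * (1 - γ)) * δ + (q - 2 * γ) * δ ^ 2 + δ ^ 3 with hf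
  have hγ0 : 0 < γ := by linarith
  -- To first order `δ = q / γ²`; twice that value is enough for a change of sign.
  set D := 2 * q / γ ^ 2 with hD
  have hD0 : 0 ≤ D := by positivity
  have hDq : D ≤ 2 * q := div_le_self (by linarith) (by nlinarith)
  have hDγ : D * γ ^ 2 = 2 * q := by rw [hD]; field_simp
  have hDγ1 : D * γ ≤ 2 * q := by nlinarith
  have h0 : f 0 ≤ 0 := by simp [hf]; linarith
  have h1 : 0 ≤ f D := by
    have e : f D = q - q * (D * γ) + q * D - 2 * (D * γ) * D + q * D ^ 2 + D ^ 3 := by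
      simp only [hf]; linear_combination hDγ
    rw [e]
    have e1 : q * (D * γ) ≤ q * (2 * q) := mul_le_mul_of_nonneg_left hDγ1 hq0.le
    have e2 : 2 * (D * γ) * D ≤ 2 * (2 * q) * (2 * q) := by gcongr
    have e3 : 0 ≤ q * D + q * D ^ 2 + D ^ 3 := by positivity
    nlinarith
  obtain ⟨δ, hδ, hz⟩ := intermediate_value_Icc hD0 (f := f)
    (Continuous.continuousOn (by fun_prop)) ⟨h0, h1⟩
  exact ⟨δ, hδ.1, hδ.2.trans hDq, hz⟩

/-- Solving the cubic for its linear term gives `δ = q/γ² + O(q²)`. The sum of the roots makes `q +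
δ` the damping `s` of the complex pair. -/
lemma half_add_root_sub_le {γ q δ : ℝ} (hγ : 1 < γ) (hq0 : 0 < q) (hq : q ≤ 1 / 10)
    (hδ0 : 0 ≤ δ) (hδq : δ ≤ 2 * q)
    (hδ : -q + (γ ^ 2 + q * (1 - γ)) * δ + (q - 2 * γ) * δ ^ 2 + δ ^ 3 = 0) :
    |(q + δ) / 2 - (γ ^ 2 + 1) / (2 * γ ^ 2) * q| ≤ (10 * γ + 12) * q ^ 2 := by
  have hγ0 : 0 < γ := by linarith
  have e : (q + δ) / 2 - (γ ^ 2 + 1) / (2 * γ ^ 2) * q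
      = ((γ - 1) * q * δ + (2 * γ - q) * δ ^ 2 - δ ^ 3) / (2 * γ ^ 2) := by
    field_simp; linear_combination hδ
  have hδ2 : δ ^ 2 ≤ (2 * q) ^ 2 := pow_le_pow_left₀ hδ0 hδq 2
  have h1 : |(γ - 1) * q * δ + (2 * γ - q) * δ ^ 2 - δ ^ 3| ≤ (10 * γ + 12) * q ^ 2 := by
    have g1 : q * δ ≤ 2 * q ^ 2 := by nlinarith
    have g2 : 0 ≤ q * δ := by positivity
    have g3 : δ ^ 3 ≤ δ ^ 2 := by nlinarith [sq_nonneg δ]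
    have g4 : 0 ≤ δ ^ 3 := by positivity
    have g5 : (γ - 1) * (q * δ) ≤ (γ - 1) * (2 * q ^ 2) :=
      mul_le_mul_of_nonneg_left g1 (by linarith)
    have g6 : (2 * γ - q) * δ ^ 2 ≤ 2 * γ * (4 * q ^ 2) := by nlinarith [sq_nonneg δ]
    have g7 : 0 ≤ (2 * γ - q) * δ ^ 2 := mul_nonneg (by linarith) (sq_nonneg δ)
    have g8 : 0 ≤ (γ - 1) * (q * δ) := mul_nonneg (by linarith) g2
    rw [abs_le]
    constructor <;> nlinarith [sq_nonneg q]
  rw [e, abs_div, abs_of_pos (show 0 < 2 * γ ^ 2 by positivity)]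
  exact (div_le_self (abs_nonneg _) (by nlinarith)).trans h1

/-- Factor `X - a²r²` as `(√X - ar)(√X + ar)` and divide by the second factor, which is at least
`ar`. -/
lemma sqrt_expansion {a r X M : ℝ} (ha : 0 < a) (hr : 0 < r)
    (h : |X - a ^ 2 * r ^ 2| ≤ M * r ^ 4) (hX : a ^ 2 * r ^ 2 / 4 ≤ X) :
    a * r / 2 ≤ √X ∧ √X ^ 2 = X ∧ |√X - a * r| ≤ M / a * r ^ 3 := by
  have hsq : √X ^ 2 = X := Real.sq_sqrt (le_trans (by positivity) hX)
  have h0 : 0 ≤ √X := Real.sqrt_nonneg _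
  have har : 0 < a * r := mul_pos ha hr
  refine ⟨Real.le_sqrt_of_sq_le (by linarith), hsq, ?_⟩
  have h1 : |√X - a * r| * (a * r) ≤ M * r ^ 4 := by
    refine le_trans ?_ h
    nth_rw 2 [← hsq]
    rw [show √X ^ 2 - a ^ 2 * r ^ 2 = (√X - a * r) * (√X + a * r) by ring, abs_mul]
    refine mul_le_mul_of_nonneg_left ?_ (abs_nonneg _)
    rw [abs_of_nonneg (by positivity)]
    linarith
  rw [← le_div_iff₀ har] at h1
  refine h1.trans (le_of_eq ?_)
  field_simp

/-- The product of the roots forces `s²/4 + om² = (γ-1) q / l` with `l = γ - δ`, so the first two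
terms give `om²`; replacing `l` by `γ` costs `O(q²)`. -/
lemma quadratic_factor_expansion {γ q δ : ℝ} (hγ : 1 < γ) (hq0 : 0 < q) (hδ0 : 0 ≤ δ)
    (hδq : δ ≤ 2 * q) (hl : γ / 2 ≤ γ - δ) :
    |(γ - 1) * q / (γ - δ) - (q + δ) ^ 2 / 4 - (γ - 1) / γ * q| ≤ (4 * γ + 3) * q ^ 2 := by
  have hγ0 : 0 < γ := by linarith
  have hl0 : 0 < γ - δ := by linarith
  have hpa : (γ - 1) * q / (γ - δ) - (γ - 1) / γ * q
      = (γ - 1) / γ * (q * δ / (γ - δ)) := by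
    field_simp; ring
  have hX0 : 0 ≤ q * δ / (γ - δ) := by positivity
  have hX1 : q * δ / (γ - δ) ≤ 4 * q ^ 2 := by
    rw [div_le_iff₀ hl0]
    nlinarith [mul_le_mul_of_nonneg_left hδq hq0.le, mul_pos hq0 hq0]
  have h1 : (γ - 1) / γ ≤ 1 := by rw [div_le_one hγ0]; linarith
  have h2 : 0 ≤ (γ - 1) / γ := div_nonneg (by linarith) hγ0.le
  have h3 : (γ - 1) / γ * (q * δ / (γ - δ)) ≤ 4 * q ^ 2 :=
    (mul_le_of_le_one_left hX0 h1).trans hX1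
  have h4 : 0 ≤ (γ - 1) / γ * (q * δ / (γ - δ)) := mul_nonneg h2 hX0
  have h5 : (q + δ) ^ 2 ≤ (3 * q) ^ 2 := pow_le_pow_left₀ (by positivity) (by linarith) 2
  have h6 : 4 * q ^ 2 ≤ 4 * γ * q ^ 2 := by nlinarith [mul_pos hq0 hq0]
  have h7 := sq_nonneg (q + δ)
  have h8 := sq_nonneg q
  rw [abs_le]
  constructor <;> linarith

lemma exists_charRoots {γ : ℝ} (hγ : 1 < γ) :
    ∃ K ε₀ : ℝ, 0 < K ∧ 0 < ε₀ ∧ ε₀ ≤ 1 / 4 ∧ ∀ r : ℝ, 0 < r → r < ε₀ →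
      ∃ s om l : ℝ, CharRoots γ K r s om l := by
  have hγ0 : 0 < γ := by linarith
  obtain ⟨a, ha⟩ : ∃ a, a = √((γ - 1) / γ) := ⟨_, rfl⟩
  have ha2 : a ^ 2 = (γ - 1) / γ := by
    rw [ha]; exact Real.sq_sqrt (div_nonneg (by linarith) hγ0.le)
  have ha0 : 0 < a := by rw [ha]; exact Real.sqrt_pos.2 (div_pos (by linarith) hγ0)
  obtain ⟨M, hM⟩ : ∃ M, M = 4 * γ + 3 := ⟨_, rfl⟩
  have hM1 : 1 ≤ M := by linarith
  have hMa : 0 < M / a := by positivity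
  -- `M` is the constant in the expansion of `om²`. The bound `r < a/(2M)` keeps the error below
  -- half of `a² r²`, so that `om² > 0` and the pair is not real.
  refine ⟨M / a + 10 * γ + 12, min (1 / 4) (a / (2 * M)), by positivity, by positivity,
    min_le_left _ _, fun r hr hrε => ?_⟩
  have hr1 : r < 1 / 4 := hrε.trans_le (min_le_left _ _)
  have hr2 : r * (2 * M) < a := (lt_div_iff₀ (by positivity)).1 (hrε.trans_le (min_le_right _ _))
  obtain ⟨q, hq⟩ : ∃ q, q = r ^ 2 := ⟨_, rfl⟩
  have hq0 : 0 < q := by rw [hq]; positivity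
  have hq1 : q ≤ 1 / 10 := by nlinarith
  have hr4 : r ^ 4 = q ^ 2 := by rw [hq]; ring
  obtain ⟨δ, hδ0, hδq, hδ⟩ := exists_real_root hγ hq0 hq1
  have hl : γ / 2 ≤ γ - δ := by linarith
  have hl0 : 0 < γ - δ := by linarith
  have hom2 := quadratic_factor_expansion hγ hq0 hδ0 hδq hl
  obtain ⟨p, hp⟩ : ∃ p, p = (γ - 1) * q / (γ - δ) := ⟨_, rfl⟩
  have hpl : p * (γ - δ) = (γ - 1) * q := by rw [hp]; exact div_mul_cancel₀ _ hl0.ne'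
  -- After multiplication by `l = γ - δ`, this Vieta relation is the cubic equation for `δ`.
  have hlin : p + (q + δ) * (γ - δ) = (1 + γ) * q := by
    have : (p + (q + δ) * (γ - δ)) * (γ - δ) = (1 + γ) * q * (γ - δ) := by
      rw [add_mul, hpl]; linear_combination hδ
    exact mul_right_cancel₀ hl0.ne' this
  rw [← hp, ← ha2, ← hM] at hom2
  have hMq : M * q ^ 2 ≤ a ^ 2 * q / 2 := by
    have hra : r ≤ a := by nlinarith
    have h1 : M * r * r ≤ a / 2 * a := by gcongr; linarith
    have h2 : M * q * q ≤ a ^ 2 / 2 * q := by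
      refine mul_le_mul_of_nonneg_right ?_ hq0.le
      rw [hq]; linarith
    linarith
  have haq : 0 < a ^ 2 * q := by positivity
  obtain ⟨h1, h2, h3⟩ := sqrt_expansion (M := M) ha0 hr (by rw [← hq, hr4]; exact hom2)
    (by rw [← hq]; linarith [(abs_le.1 hom2).1])
  refine ⟨q + δ, √(p - (q + δ) ^ 2 / 4), γ - δ, ?_, by linarith, by linarith, hl, by
    rw [hq]; ring, ?_, ?_, ?_, ?_, ?_⟩
  · rw [← ha]; exact h1
  · rw [h2, ← hq]; linarith
  · rw [h2, ← hq]; linarith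
  · rw [← ha]
    refine h3.trans (mul_le_mul_of_nonneg_right ?_ (by positivity))
    linarith
  · rw [hr4, ← hq]
    refine (half_add_root_sub_le hγ hq0 hq1 hδ0 hδq hδ).trans ?_
    refine mul_le_mul_of_nonneg_right ?_ (by positivity)
    linarith
  · rw [show γ - (γ - δ) = δ by ring, abs_of_nonneg hδ0, ← hq]
    refine hδq.trans (mul_le_mul_of_nonneg_right ?_ hq0.le)
    linarith

end Roots

/-! ### Explicit solution of the system. -/

section Flow

/-- The eigenvector is normalized by its memory component. This avoids dividing by `γ + λ`, which is
small at the real root. -/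
lemma solutionFlow_eigenvector (γ q t : ℝ) (lam : ℂ)
    (h : lam ^ 3 + (γ + q) * lam ^ 2 + (1 + γ) * q * lam + (γ - 1) * q = 0) :
    solutionFlow γ q t (γ + lam, lam * (γ + lam), 1)
      = Complex.exp (lam * t) • ((γ + lam, lam * (γ + lam), 1) : ℂ × ℂ × ℂ) := by
  refine propagator_apply_eigenvector _ _ _ _ _ _ ?_
  simp only [generatorConst_apply, generatorSq_apply, Prod.smul_mk, Prod.mk_add_mk, smul_eq_mul,
    Prod.mk.injEq]
  refine ⟨by ring, ?_, by ring⟩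
  linear_combination -h

/-- The initial vector is expanded in the eigenbasis. The components of the expansion are second
divided differences at `l₁, l₂, l₃` of polynomials of degree at most three, which is why the
denominators are products of differences of roots. -/
lemma solutionFlow_apply_fst {γ q : ℝ} (t : ℝ) {l₁ l₂ l₃ : ℂ}
    (hsum : l₁ + l₂ + l₃ = -(γ + q)) (hpair : l₁ * l₂ + l₁ * l₃ + l₂ * l₃ = (1 + γ) * q)
    (hprod : l₁ * l₂ * l₃ = -((γ - 1) * q))
    (h₁₂ : l₁ - l₂ ≠ 0) (h₁₃ : l₁ - l₃ ≠ 0) (h₂₃ : l₂ - l₃ ≠ 0) (y₀ y₁ : ℂ) :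
    (solutionFlow γ q t (y₀, y₁, 0)).1 =
      ((l₁ + q) * y₀ + y₁) * ((γ + l₁) / ((l₁ - l₂) * (l₁ - l₃)) * Complex.exp (l₁ * t))
      + ((l₂ + q) * y₀ + y₁) * ((γ + l₂) / ((l₂ - l₁) * (l₂ - l₃)) * Complex.exp (l₂ * t))
      + ((l₃ + q) * y₀ + y₁) * ((γ + l₃) / ((l₃ - l₁) * (l₃ - l₂)) * Complex.exp (l₃ * t)) := by
  have hroot (x : ℂ) (hx : (x - l₁) * (x - l₂) * (x - l₃) = 0) :
      x ^ 3 + (γ + q) * x ^ 2 + (1 + γ) * q * x + (γ - 1) * q = 0 := by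
    linear_combination hx + x ^ 2 * hsum - x * hpair + hprod
  have h₂₁ : l₂ - l₁ ≠ 0 := by rwa [← neg_sub, neg_ne_zero]
  have h₃₁ : l₃ - l₁ ≠ 0 := by rwa [← neg_sub, neg_ne_zero]
  have h₃₂ : l₃ - l₂ ≠ 0 := by rwa [← neg_sub, neg_ne_zero]
  set c₁ := ((l₁ + q) * y₀ + y₁) / ((l₁ - l₂) * (l₁ - l₃)) with hc₁
  set c₂ := ((l₂ + q) * y₀ + y₁) / ((l₂ - l₁) * (l₂ - l₃)) with hc₂
  set c₃ := ((l₃ + q) * y₀ + y₁) / ((l₃ - l₁) * (l₃ - l₂)) with hc₃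
  -- Eliminating `γ` by the sum of the roots turns the decomposition into a rational identity in the
  -- roots and `q`.
  have hγ : (γ : ℂ) = -(l₁ + l₂ + l₃) - q := by linear_combination hsum
  have hdec : ((y₀, y₁, 0) : ℂ × ℂ × ℂ) = c₁ • (γ + l₁, l₁ * (γ + l₁), 1)
      + c₂ • (γ + l₂, l₂ * (γ + l₂), 1) + c₃ • (γ + l₃, l₃ * (γ + l₃), 1) := by
    simp only [Prod.smul_mk, Prod.mk_add_mk, smul_eq_mul, Prod.mk.injEq, hc₁, hc₂, hc₃, hγ]
    refine ⟨?_, ?_, ?_⟩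
    · field_simp
      ring
    · field_simp
      ring
    · field_simp
      ring
  rw [hdec, map_add, map_add, map_smul, map_smul, map_smul,
    solutionFlow_eigenvector γ q t l₁ (hroot l₁ (by ring)),
    solutionFlow_eigenvector γ q t l₂ (hroot l₂ (by ring)),
    solutionFlow_eigenvector γ q t l₃ (hroot l₃ (by ring))]
  simp only [Prod.smul_mk, Prod.mk_add_mk, smul_eq_mul, hc₁, hc₂, hc₃]
  ring

end Flow

/-! ### Amplitudes of the oscillating modes. -/

section Coefficients

/-- The oscillating characteristic roots. -/
def oscRoot (s om σ : ℝ) : ℂ := -(s / 2 : ℝ) + (σ : ℂ) * Complex.I * (om : ℝ)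

/-- The coefficient of `exp (oscRoot t)` in the response to the initial velocity. -/
def oscCoeff (γ s om l σ : ℝ) : ℂ :=
  (γ + oscRoot s om σ) /
    ((oscRoot s om σ - oscRoot s om (-σ)) * (oscRoot s om σ - (-l : ℝ)))

/-- The amplitude in `symbolJ0Part`. -/
def amplitudeJ0 (γ σ r : ℝ) : ℂ :=
  ((σ : ℂ) * Complex.I * (√(γ * (γ - 1)) : ℝ) + ((γ - 1) ^ 2 / (2 * γ) : ℝ) * r)
    / ((σ : ℂ) * 2 * Complex.I * (√(γ * (γ - 1)) : ℝ) - (2 * (γ - 1) / γ : ℝ) * r)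

/-- The amplitude in `symbolJ1Part`. -/
def amplitudeJ1 (γ σ r : ℝ) : ℂ :=
  ((γ : ℂ) + (σ : ℂ) * Complex.I * (√((γ - 1) / γ) : ℝ) * r
      - ((γ ^ 2 + 1) / (2 * γ ^ 2) : ℝ) * r ^ 2)
    / ((σ : ℂ) * 2 * Complex.I * (√(γ * (γ - 1)) : ℝ) * r - (2 * (γ - 1) / γ : ℝ) * r ^ 2)

/-- The leading amplitude `1 / (2 i σ a r)` of the response to the initial velocity. -/
def leadingAmplitude (γ σ r : ℝ) : ℂ :=
  1 / ((σ : ℂ) * 2 * Complex.I * (√((γ - 1) / γ) * r : ℝ))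

lemma speed_pos {γ : ℝ} (hγ : 1 < γ) : 0 < √((γ - 1) / γ) :=
  Real.sqrt_pos.2 (div_pos (by linarith) (by linarith))

lemma speed_le_one {γ : ℝ} (hγ : 1 < γ) : √((γ - 1) / γ) ≤ 1 := by
  rw [Real.sqrt_le_one, div_le_one (by linarith)]
  linarith

lemma sqrt_mul_eq_mul_speed {γ : ℝ} (hγ : 1 < γ) :
    √(γ * (γ - 1)) = γ * √((γ - 1) / γ) := by
  have h0 : 0 < γ := by linarith
  rw [show γ * (γ - 1) = γ ^ 2 * ((γ - 1) / γ) by field_simp,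
    Real.sqrt_mul (by positivity), Real.sqrt_sq h0.le]

lemma norm_sign {σ : ℝ} (hσ : σ = 1 ∨ σ = -1) : ‖(σ : ℂ)‖ = 1 := by
  rcases hσ with rfl | rfl <;> simp

lemma sign_ne_zero {σ : ℝ} (hσ : σ = 1 ∨ σ = -1) : (σ : ℂ) ≠ 0 :=
  norm_ne_zero_iff.1 (by rw [norm_sign hσ]; norm_num)

lemma norm_leadingAmplitude {γ σ r : ℝ} (hγ : 1 < γ) (hσ : σ = 1 ∨ σ = -1) (hr : 0 < r) :
    ‖leadingAmplitude γ σ r‖ = 1 / (2 * √((γ - 1) / γ)) / r := by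
  have := speed_pos hγ
  rw [leadingAmplitude, norm_div, norm_one, norm_mul, norm_mul, norm_mul, norm_sign hσ,
    Complex.norm_I, Complex.norm_real, Real.norm_of_nonneg (by positivity)]
  simp
  field_simp

/-- Subtracting half the denominator from the numerator cancels the imaginary parts and leaves a
real multiple of `r`. -/
lemma norm_amplitudeJ0_sub_le {γ σ r : ℝ} (hγ : 1 < γ) (hσ : σ = 1 ∨ σ = -1) (hr : 0 ≤ r) :
    ‖amplitudeJ0 γ σ r - 1 / 2‖
      ≤ ((γ - 1) ^ 2 / (2 * γ) + (γ - 1) / γ) / √(γ * (γ - 1)) * r := by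
  have hP := sqrt_pos_aux hγ
  have h0 : 0 < γ := by linarith
  have hden := den_ne_zero (√(γ * (γ - 1))) (2 * (γ - 1) / γ * r) hP σ hσ
  have hle := le_norm_den (√(γ * (γ - 1))) (2 * (γ - 1) / γ * r) hP.le σ hσ
  rw [Complex.ofReal_mul] at hden hle
  have e : amplitudeJ0 γ σ r - 1 / 2 = (((γ - 1) ^ 2 / (2 * γ) + (γ - 1) / γ) * r : ℝ)
      / ((σ : ℂ) * 2 * Complex.I * (√(γ * (γ - 1)) : ℝ) - (2 * (γ - 1) / γ : ℝ) * r) := by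
    rw [amplitudeJ0, div_sub' hden, div_eq_div_iff (by simpa using hden) hden]
    push_cast
    ring
  have hb : 0 ≤ ((γ - 1) ^ 2 / (2 * γ) + (γ - 1) / γ) * r := by
    have : 0 ≤ (γ - 1) / γ := div_nonneg (by linarith) h0.le
    positivity
  rw [e, norm_div, Complex.norm_real, Real.norm_of_nonneg hb, div_mul_eq_mul_div]
  gcongr

/-- The `1/r` singularities cancel because `√(γ(γ-1)) = γ a`, where `a = √((γ-1)/γ)`; the remaining
numerator and the common denominator are both of order `r²`. -/
lemma norm_amplitudeJ1_sub_le {γ : ℝ} (hγ : 1 < γ) :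
    ∃ K : ℝ, 0 ≤ K ∧ ∀ σ r : ℝ, (σ = 1 ∨ σ = -1) → 0 < r → r ≤ 1 →
      ‖amplitudeJ1 γ σ r - leadingAmplitude γ σ r‖ ≤ K := by
  have hP := sqrt_pos_aux hγ
  have h0 : 0 < γ := by linarith
  have ha := speed_pos hγ
  have hPa := sqrt_mul_eq_mul_speed hγ
  set a := √((γ - 1) / γ)
  set P := √(γ * (γ - 1))
  set b := (γ ^ 2 + 1) / (2 * γ ^ 2) with hb
  set d := 2 * (γ - 1) / γ with hd
  have hb0 : 0 ≤ b := by positivity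
  have hd0 : 0 ≤ d := div_nonneg (by linarith) h0.le
  refine ⟨(2 * a * (a + b) + d) / (P * (2 * a)), by positivity, fun σ r hσ hr hr1 => ?_⟩
  have hden := den_ne_zero (P * r) (d * r ^ 2) (by positivity) σ hσ
  have hle := le_norm_den (P * r) (d * r ^ 2) (by positivity) σ hσ
  have e0 : (σ : ℂ) * 2 * Complex.I * (P * r : ℝ) - (d * r ^ 2 : ℝ)
      = (σ : ℂ) * 2 * Complex.I * P * r - d * r ^ 2 := by push_cast; ring
  rw [e0] at hden hle
  have hden2 : (σ : ℂ) * 2 * Complex.I * (a * r : ℝ) ≠ 0 := by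
    have : (a * r : ℝ) ≠ 0 := by positivity
    have h1 : ((a * r : ℝ) : ℂ) ≠ 0 := by exact_mod_cast this
    exact mul_ne_zero (mul_ne_zero (mul_ne_zero (sign_ne_zero hσ) two_ne_zero)
      Complex.I_ne_zero) h1
  have e : amplitudeJ1 γ σ r - leadingAmplitude γ σ r
      = ((σ : ℂ) * 2 * Complex.I * (a * r : ℝ) * (σ * Complex.I * (a * r : ℝ) - (b * r ^ 2 : ℝ))
          + (d * r ^ 2 : ℝ))
        / (((σ : ℂ) * 2 * Complex.I * P * r - d * r ^ 2)
          * ((σ : ℂ) * 2 * Complex.I * (a * r : ℝ))) := by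
    have e1 : amplitudeJ1 γ σ r = ((γ : ℂ) + (σ : ℂ) * Complex.I * a * r - b * r ^ 2)
      / ((σ : ℂ) * 2 * Complex.I * P * r - d * r ^ 2) := rfl
    have e2 : leadingAmplitude γ σ r = 1 / ((σ : ℂ) * 2 * Complex.I * (a * r : ℝ)) := rfl
    rw [e1, e2, div_sub_div _ _ hden hden2]
    congr 1
    rw [hPa]
    push_cast
    ring
  rw [e, norm_div, norm_mul, norm_mul, norm_mul, norm_mul, norm_sign hσ, Complex.norm_I,
    Complex.norm_real, Real.norm_of_nonneg (by positivity : 0 ≤ a * r)]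
  have h2 : ‖(2 : ℂ)‖ = 2 := by simp
  rw [h2, one_mul, mul_one]
  have hnum : ‖(σ : ℂ) * 2 * Complex.I * (a * r : ℝ) *
      (σ * Complex.I * (a * r : ℝ) - (b * r ^ 2 : ℝ)) + (d * r ^ 2 : ℝ)‖
        ≤ (2 * a * (a + b) + d) * r ^ 2 := by
    refine (norm_add_le _ _).trans ?_
    rw [norm_mul, norm_mul, norm_mul, norm_mul, norm_sign hσ, Complex.norm_I, h2,
      Complex.norm_real, Complex.norm_real, Real.norm_of_nonneg (by positivity : 0 ≤ a * r),
      Real.norm_of_nonneg (by positivity : 0 ≤ d * r ^ 2)]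
    have h3 : ‖σ * Complex.I * (a * r : ℝ) - (b * r ^ 2 : ℝ)‖ ≤ (a + b) * r := by
      refine (norm_sub_le _ _).trans ?_
      rw [norm_mul, norm_mul, norm_sign hσ, Complex.norm_I, Complex.norm_real, Complex.norm_real,
        Real.norm_of_nonneg (by positivity : 0 ≤ a * r),
        Real.norm_of_nonneg (by positivity : 0 ≤ b * r ^ 2)]
      nlinarith [mul_nonneg hb0 (mul_nonneg hr.le (sub_nonneg.2 hr1))]
    have h4 : 2 * (a * r) * ‖σ * Complex.I * (a * r : ℝ) - (b * r ^ 2 : ℝ)‖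
        ≤ 2 * (a * r) * ((a + b) * r) := by gcongr
    linarith
  rw [div_le_div_iff₀ (by positivity) (by positivity)]
  calc _ ≤ (2 * a * (a + b) + d) * r ^ 2 * (P * (2 * a)) := by gcongr
    _ = (2 * a * (a + b) + d) * ((P * r) * (2 * (a * r))) := by ring
    _ ≤ _ := by gcongr

variable {γ K r s om l : ℝ}

lemma oscRoot_sub_neg (s om σ : ℝ) :
    oscRoot s om σ - oscRoot s om (-σ) = (σ : ℂ) * 2 * Complex.I * (om : ℝ) := by
  simp only [oscRoot]
  push_cast
  ring

/-- The real parts are separated: `l ≥ γ/2 > 1/2`, while `s/2 ≤ 3r²/2 ≤ 3/32`. -/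
lemma CharRoots.quarter_le_norm (h : CharRoots γ K r s om l) (hγ : 1 < γ) (hr : 0 < r)
    (hr1 : r ≤ 1 / 4) (σ : ℝ) : 1 / 4 ≤ ‖oscRoot s om σ - (-l : ℝ)‖ := by
  refine le_trans ?_ (Complex.re_le_norm _)
  simp only [oscRoot, Complex.sub_re, Complex.add_re, Complex.neg_re, Complex.ofReal_re,
    Complex.mul_re, Complex.I_re, Complex.I_im, Complex.ofReal_im, Complex.mul_im]
  have := h.s_le
  have := h.l_ge
  nlinarith

lemma CharRoots.omega_pos (h : CharRoots γ K r s om l) (hγ : 1 < γ) (hr : 0 < r) : 0 < om :=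
  lt_of_lt_of_le (by have := speed_pos hγ; positivity) h.omega_ge

/-- Write `(γ + λ)/(λ + l) = 1 + (γ - l)/(λ + l)`. The correction is `O(r²)` and is divided by `om`,
of order `r`; replacing `1/om` by `1/(ar)` costs `O(r³)/r²`. -/
lemma CharRoots.norm_oscCoeff_sub_le (h : CharRoots γ K r s om l) (hγ : 1 < γ) (hK : 0 ≤ K)
    (hr : 0 < r) (hr1 : r ≤ 1 / 4) {σ : ℝ} (hσ : σ = 1 ∨ σ = -1) :
    ‖oscCoeff γ s om l σ - leadingAmplitude γ σ r‖
      ≤ K / √((γ - 1) / γ) ^ 2 + 4 * K / √((γ - 1) / γ) := by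
  have hom := h.omega_pos hγ hr
  have hge := h.omega_ge
  have ha := speed_pos hγ
  have h1 := h.omega_sub
  have h2 := h.l_sub
  have hD := h.quarter_le_norm hγ hr hr1 σ
  set a := √((γ - 1) / γ)
  have hD0 : oscRoot s om σ - (-l : ℝ) ≠ 0 := norm_ne_zero_iff.1 (by linarith)
  have hD0' : oscRoot s om σ + l ≠ 0 := by simpa using hD0
  have hom' : (om : ℂ) ≠ 0 := by exact_mod_cast hom.ne'
  have ha' : (a : ℂ) ≠ 0 := by exact_mod_cast ha.ne'
  have hr' : (r : ℂ) ≠ 0 := by exact_mod_cast hr.ne'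
  have hσ0 := sign_ne_zero hσ
  have e : oscCoeff γ s om l σ - leadingAmplitude γ σ r = 1 / ((σ : ℂ) * 2 * Complex.I) *
      (((a * r - om) / (om * (a * r)) : ℝ) + ((γ - l) / om : ℝ) /
        (oscRoot s om σ - (-l : ℝ))) := by
    have e2 : leadingAmplitude γ σ r = 1 / ((σ : ℂ) * 2 * Complex.I * (a * r : ℝ)) := rfl
    rw [oscCoeff, e2, oscRoot_sub_neg]
    push_cast
    rw [sub_neg_eq_add]
    field_simp
    ring
  have hn : ‖1 / ((σ : ℂ) * 2 * Complex.I)‖ = 1 / 2 := by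
    rw [norm_div, norm_mul, norm_mul, norm_sign hσ]; simp
  rw [e, norm_mul, hn]
  have t1 : ‖(((a * r - om) / (om * (a * r)) : ℝ) : ℂ)‖ ≤ 2 * K / a ^ 2 := by
    rw [Complex.norm_real, norm_div, Real.norm_eq_abs, abs_sub_comm,
      Real.norm_of_nonneg (by positivity : 0 ≤ om * (a * r)),
      div_le_div_iff₀ (by positivity) (by positivity)]
    calc |om - a * r| * a ^ 2 ≤ K * r ^ 3 * a ^ 2 := by gcongr
      _ ≤ K * r ^ 2 * a ^ 2 := by
        have : r ^ 3 ≤ r ^ 2 := by nlinarith [sq_nonneg r]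
        gcongr
      _ = 2 * K * (a * r / 2 * (a * r)) := by ring
      _ ≤ _ := by gcongr
  have t2 : ‖((γ - l) / om : ℝ) / (oscRoot s om σ - (-l : ℝ))‖ ≤ 8 * K / a := by
    rw [norm_div, Complex.norm_real, norm_div, Real.norm_eq_abs, Real.norm_of_nonneg hom.le,
      div_div, div_le_div_iff₀ (by positivity) (by positivity)]
    calc |γ - l| * a ≤ K * r ^ 2 * a := by gcongr
      _ ≤ K * r * a := by
        have : r ^ 2 ≤ r := by nlinarith
        gcongr
      _ = 8 * K * (a * r / 2 * (1 / 4)) := by ring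
      _ ≤ _ := by gcongr
  have := (norm_add_le (((a * r - om) / (om * (a * r)) : ℝ) : ℂ)
    (((γ - l) / om : ℝ) / (oscRoot s om σ - (-l : ℝ)))).trans (add_le_add t1 t2)
  refine (mul_le_mul_of_nonneg_left this (by norm_num)).trans (le_of_eq ?_)
  ring

/-- To leading order the prefactor is `iσar`, whose product with the leading amplitude is exactly
`1/2`. Its remainder is `O(r²)` against an amplitude of size `1/r`. -/
lemma CharRoots.norm_oscCoeff_mul_sub_le (h : CharRoots γ K r s om l) (hγ : 1 < γ) (hK : 0 ≤ K)
    (hr : 0 < r) (hr1 : r ≤ 1 / 4) {σ : ℝ} (hσ : σ = 1 ∨ σ = -1) {K₁ : ℝ}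
    (hK₁ : ‖oscCoeff γ s om l σ - leadingAmplitude γ σ r‖ ≤ K₁) :
    ‖(oscRoot s om σ + (r ^ 2 : ℝ)) * oscCoeff γ s om l σ - 1 / 2‖
      ≤ ((4 + K) * K₁ + (3 + K) * (1 / (2 * √((γ - 1) / γ)))) * r := by
  have ha := speed_pos hγ
  have ha1 := speed_le_one hγ
  have h1 := h.omega_sub
  have hs := h.s_le
  have hs' := h.s_ge
  have hlead := norm_leadingAmplitude hγ hσ hr
  have hK₁0 := (norm_nonneg _).trans hK₁
  have har : (√((γ - 1) / γ) * r : ℝ) ≠ 0 := by positivity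
  set a := √((γ - 1) / γ)
  have hσ0 := sign_ne_zero hσ
  have hlm : leadingAmplitude γ σ r * ((σ : ℂ) * Complex.I * (a * r : ℝ)) = 1 / 2 := by
    have e2 : leadingAmplitude γ σ r = 1 / ((σ : ℂ) * 2 * Complex.I * (a * r : ℝ)) := rfl
    rw [e2]
    have : ((a * r : ℝ) : ℂ) ≠ 0 := by exact_mod_cast har
    field_simp
  have e : (oscRoot s om σ + (r ^ 2 : ℝ)) * oscCoeff γ s om l σ - 1 / 2
      = (oscRoot s om σ + (r ^ 2 : ℝ)) * (oscCoeff γ s om l σ - leadingAmplitude γ σ r)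
        + ((r ^ 2 - s / 2 : ℝ) + (σ : ℂ) * Complex.I * (om - a * r : ℝ))
          * leadingAmplitude γ σ r := by
    rw [← hlm, oscRoot]
    push_cast
    ring
  have hr2 : r ^ 2 ≤ r := by nlinarith
  have hr3 : r ^ 3 ≤ r ^ 2 := by nlinarith [sq_nonneg r]
  have hsmall : ‖((r ^ 2 - s / 2 : ℝ) + (σ : ℂ) * Complex.I * (om - a * r : ℝ) : ℂ)‖
      ≤ (3 + K) * r ^ 2 := by
    refine (norm_add_le _ _).trans ?_
    rw [norm_mul, norm_mul, norm_sign hσ, Complex.norm_I, Complex.norm_real, Complex.norm_real,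
      Real.norm_eq_abs, Real.norm_eq_abs]
    have : |r ^ 2 - s / 2| ≤ 3 * r ^ 2 := abs_le.2 ⟨by linarith, by linarith⟩
    have : K * r ^ 3 ≤ K * r ^ 2 := by gcongr
    linarith
  have hbig : ‖oscRoot s om σ + (r ^ 2 : ℝ)‖ ≤ (4 + K) * r := by
    have e2 : oscRoot s om σ + (r ^ 2 : ℝ) = ((r ^ 2 - s / 2 : ℝ) +
        (σ : ℂ) * Complex.I * (om - a * r : ℝ)) + (σ : ℂ) * Complex.I * (a * r : ℝ) := by
      rw [oscRoot]; push_cast; ring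
    rw [e2]
    refine (norm_add_le _ _).trans ?_
    rw [norm_mul, norm_mul, norm_sign hσ, Complex.norm_I, Complex.norm_real,
      Real.norm_of_nonneg (by positivity : 0 ≤ a * r)]
    have : (3 + K) * r ^ 2 ≤ (3 + K) * r := by gcongr
    nlinarith
  rw [e]
  refine (norm_add_le _ _).trans ?_
  rw [norm_mul, norm_mul, hlead, add_mul]
  refine add_le_add ?_ ?_
  · calc _ ≤ (4 + K) * r * K₁ := by gcongr
      _ = _ := by ring
  · calc _ ≤ (3 + K) * r ^ 2 * (1 / (2 * a) / r) := by gcongr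
      _ = _ := by field_simp

end Coefficients

/-! ### Comparison of modes and profiles at a fixed frequency. -/

section Pointwise

lemma norm_cexp_sub_cexp_le {z w : ℂ} {M : ℝ} (hz : z.re ≤ M) (hw : w.re ≤ M) :
    ‖Complex.exp z - Complex.exp w‖ ≤ Real.exp M * ‖z - w‖ := by
  refine Convex.norm_image_sub_le_of_norm_deriv_le (𝕜 := ℂ) (f := Complex.exp)
    (s := {z : ℂ | z.re ≤ M}) (fun x _ => Complex.differentiableAt_exp) (fun x hx => ?_)
    (convex_halfSpace_re_le M) hw hz
  rw [Complex.deriv_exp, Complex.norm_exp]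
  exact Real.exp_le_exp.2 hx

lemma mul_exp_neg_half_le (x : ℝ) : x * Real.exp (-(x / 2)) ≤ 4 * Real.exp (-(x / 4)) := by
  have h1 := Real.add_one_le_exp (x / 4)
  have h2 : Real.exp (-(x / 4)) = Real.exp (x / 4) * Real.exp (-(x / 2)) := by
    rw [← Real.exp_add]; ring_nf
  rw [h2]
  nlinarith [Real.exp_pos (-(x / 2))]

variable {γ K r s om l : ℝ}

lemma norm_waveFactor_le (hγ : 1 < γ) {t : ℝ} (ht : 0 ≤ t) (σ r : ℝ) :
    ‖waveFactor γ t σ r‖ ≤ Real.exp (-(r ^ 2 * t / 2)) := by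
  rw [norm_waveFactor]
  refine Real.exp_le_exp.2 ?_
  have hb : 1 / 2 ≤ (γ ^ 2 + 1) / (2 * γ ^ 2) := by
    rw [div_le_div_iff₀ (by norm_num) (by positivity)]
    nlinarith
  nlinarith [mul_nonneg (sq_nonneg r) ht]

lemma CharRoots.norm_cexp_oscRoot_le (h : CharRoots γ K r s om l) {t : ℝ} (ht : 0 ≤ t) (σ : ℝ) :
    ‖Complex.exp (oscRoot s om σ * t)‖ ≤ Real.exp (-(r ^ 2 * t / 2)) := by
  rw [Complex.norm_exp]
  refine Real.exp_le_exp.2 ?_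
  have hs := h.s_ge
  have : (oscRoot s om σ * t).re = -(s / 2) * t := by simp [oscRoot]
  rw [this]
  nlinarith

/-- The exponents differ by `O(r³ t)`. By the mean value inequality in a half-plane this multiplies
`e^{-r²t/2}`; half of the exponent absorbs `r² t` and one factor `r` survives. -/
lemma CharRoots.norm_cexp_sub_waveFactor_le (h : CharRoots γ K r s om l) (hγ : 1 < γ)
    (hK : 0 ≤ K) (hr : 0 < r) (hr1 : r ≤ 1 / 4) {σ t : ℝ} (hσ : σ = 1 ∨ σ = -1) (ht : 0 ≤ t) :
    ‖Complex.exp (oscRoot s om σ * t) - waveFactor γ t σ r‖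
      ≤ 8 * K * r * Real.exp (-(r ^ 2 * t / 4)) := by
  have h1 := h.norm_cexp_oscRoot_le ht σ
  have h2 := norm_waveFactor_le hγ ht σ r
  have hom := h.omega_sub
  have hs := h.s_sub
  rw [waveFactor] at h2 ⊢
  rw [Complex.norm_exp, Real.exp_le_exp] at h1 h2
  refine (norm_cexp_sub_cexp_le h1 h2).trans ?_
  have e : oscRoot s om σ * t - ((σ : ℂ) * Complex.I * (√((γ - 1) / γ) : ℝ) * r * t
      - ((γ ^ 2 + 1) / (2 * γ ^ 2) : ℝ) * r ^ 2 * t)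
      = ((-(s / 2 - (γ ^ 2 + 1) / (2 * γ ^ 2) * r ^ 2) : ℝ)
        + (σ : ℂ) * Complex.I * (om - √((γ - 1) / γ) * r : ℝ)) * (t : ℝ) := by
    rw [oscRoot]; push_cast; ring
  rw [e, norm_mul, Complex.norm_real, Real.norm_of_nonneg ht]
  have h3 : ‖((-(s / 2 - (γ ^ 2 + 1) / (2 * γ ^ 2) * r ^ 2) : ℝ)
        + (σ : ℂ) * Complex.I * (om - √((γ - 1) / γ) * r : ℝ) : ℂ)‖ ≤ 2 * K * r ^ 3 := by
    refine (norm_add_le _ _).trans ?_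
    rw [norm_mul, norm_mul, norm_sign hσ, Complex.norm_I, Complex.norm_real, Complex.norm_real,
      norm_neg, Real.norm_eq_abs, Real.norm_eq_abs]
    have : r ^ 4 ≤ r ^ 3 := pow_le_pow_of_le_one hr.le (by linarith) (by norm_num)
    have : K * r ^ 4 ≤ K * r ^ 3 := by gcongr
    linarith
  calc _ ≤ Real.exp (-(r ^ 2 * t / 2)) * (2 * K * r ^ 3 * t) := by gcongr
    _ = 2 * K * r * (r ^ 2 * t * Real.exp (-(r ^ 2 * t / 2))) := by ring
    _ ≤ 2 * K * r * (4 * Real.exp (-(r ^ 2 * t / 4))) :=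
        mul_le_mul_of_nonneg_left (mul_exp_neg_half_le _) (by positivity)
    _ = _ := by ring

/-- Both amplitudes are compared with a common simple one, `L`, so that the difference of the
exponentials is weighed only by `‖L‖`. -/
lemma norm_mul_sub_mul_le (C c L E W : ℂ) :
    ‖C * E - c * W‖ ≤ ‖C - L‖ * ‖E‖ + ‖c - L‖ * ‖W‖ + ‖L‖ * ‖E - W‖ := by
  rw [show C * E - c * W = (C - L) * E - (c - L) * W + L * (E - W) by ring]
  refine (norm_add_le _ _).trans (add_le_add ((norm_sub_le _ _).trans ?_) (norm_mul_le _ _))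
  exact add_le_add (norm_mul_le _ _) (norm_mul_le _ _)

/-- Comparison of the oscillating modes with the leading symbols. -/
lemma exists_mode_bounds (hγ : 1 < γ) (hK : 0 ≤ K) :
    ∃ B : ℝ, 0 ≤ B ∧ ∀ r s om l : ℝ, CharRoots γ K r s om l → 0 < r → r ≤ 1 / 4 →
      ∀ σ t : ℝ, (σ = 1 ∨ σ = -1) → 0 ≤ t →
        ‖(oscRoot s om σ + (r ^ 2 : ℝ)) * oscCoeff γ s om l σ
            * Complex.exp (oscRoot s om σ * t) - symbolJ0Part γ t σ r‖
          ≤ B * (r * Real.exp (-(r ^ 2 * t / 4))) ∧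
        ‖oscCoeff γ s om l σ * Complex.exp (oscRoot s om σ * t) - symbolJ1Part γ t σ r‖
          ≤ B * Real.exp (-(r ^ 2 * t / 4)) ∧
        ‖symbolJ0Part γ t σ r‖ ≤ B * Real.exp (-(r ^ 2 * t / 4)) ∧
        r * ‖symbolJ1Part γ t σ r‖ ≤ B * Real.exp (-(r ^ 2 * t / 4)) := by
  have hP := sqrt_pos_aux hγ
  have h0 : 0 < γ := by linarith
  have ha := speed_pos hγ
  obtain ⟨K₃, hK₃0, hK₃⟩ := norm_amplitudeJ1_sub_le hγ
  obtain ⟨a, hadef⟩ : ∃ a, a = √((γ - 1) / γ) := ⟨_, rfl⟩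
  rw [← hadef] at ha
  obtain ⟨K₁, hK₁⟩ : ∃ K₁, K₁ = K / a ^ 2 + 4 * K / a := ⟨_, rfl⟩
  obtain ⟨K₂, hK₂⟩ : ∃ K₂, K₂ = (4 + K) * K₁ + (3 + K) * (1 / (2 * a)) := ⟨_, rfl⟩
  obtain ⟨K₄, hK₄⟩ : ∃ K₄, K₄ = ((γ - 1) ^ 2 / (2 * γ) + (γ - 1) / γ) / √(γ * (γ - 1)) :=
    ⟨_, rfl⟩
  have hK₁0 : 0 ≤ K₁ := by rw [hK₁]; positivity
  have hK₂0 : 0 ≤ K₂ := by rw [hK₂]; positivity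
  have hK₄0 : 0 ≤ K₄ := by
    have : 0 ≤ (γ - 1) / γ := div_nonneg (by linarith) h0.le
    rw [hK₄]; positivity
  obtain ⟨L, hL⟩ : ∃ L, L = 1 / (2 * a) := ⟨_, rfl⟩
  have hL0 : 0 ≤ L := by rw [hL]; positivity
  refine ⟨K₁ + K₂ + K₃ + K₄ + L + 8 * K * L + 4 * K + 1 / 2, by positivity,
    fun r s om l h hr hr1 σ t hσ ht => ?_⟩
  have hE := h.norm_cexp_oscRoot_le ht σ
  have hW := norm_waveFactor_le hγ ht σ r
  have hEW := h.norm_cexp_sub_waveFactor_le hγ hK hr hr1 hσ ht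
  have hC1 := h.norm_oscCoeff_sub_le hγ hK hr hr1 hσ
  rw [← hadef, ← hK₁] at hC1
  have hC0 := h.norm_oscCoeff_mul_sub_le hγ hK hr hr1 hσ hC1
  rw [← hadef, ← hK₂] at hC0
  have hc0 := norm_amplitudeJ0_sub_le hγ hσ hr.le
  rw [← hK₄] at hc0
  have hc1 := hK₃ σ r hσ hr (by linarith)
  have hlead := norm_leadingAmplitude hγ hσ hr
  rw [← hadef, ← hL] at hlead
  have hJ0 : symbolJ0Part γ t σ r = amplitudeJ0 γ σ r * waveFactor γ t σ r := rfl
  have hJ1 : symbolJ1Part γ t σ r = amplitudeJ1 γ σ r * waveFactor γ t σ r := rfl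
  have h24 : Real.exp (-(r ^ 2 * t / 2)) ≤ Real.exp (-(r ^ 2 * t / 4)) :=
    Real.exp_le_exp.2 (by nlinarith [mul_nonneg (sq_nonneg r) ht])
  have hE4 := hE.trans h24
  have hW4 := hW.trans h24
  have he := Real.exp_pos (-(r ^ 2 * t / 4))
  set e := Real.exp (-(r ^ 2 * t / 4))
  have hr1' : r ≤ 1 := by linarith
  have hhalf : ‖(1 / 2 : ℂ)‖ = 1 / 2 := by norm_num
  rw [hJ0, hJ1]
  refine ⟨?_, ?_, ?_, ?_⟩
  · refine (norm_mul_sub_mul_le _ _ (1 / 2) _ _).trans ?_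
    rw [hhalf]
    calc _ ≤ K₂ * r * e + K₄ * r * e + 1 / 2 * (8 * K * r * e) := by gcongr
      _ = (K₂ + K₄ + 4 * K) * (r * e) := by ring
      _ ≤ _ := by
        refine mul_le_mul_of_nonneg_right ?_ (by positivity)
        linarith [mul_nonneg (mul_nonneg (by norm_num : (0 : ℝ) ≤ 8) hK) hL0]
  · refine (norm_mul_sub_mul_le _ _ (leadingAmplitude γ σ r) _ _).trans ?_
    rw [hlead]
    calc _ ≤ K₁ * e + K₃ * e + L / r * (8 * K * r * e) := by gcongr
      _ = (K₁ + K₃ + 8 * K * L) * e := by field_simp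
      _ ≤ _ := by
        refine mul_le_mul_of_nonneg_right ?_ (by positivity)
        linarith
  · rw [norm_mul]
    have h1 : ‖amplitudeJ0 γ σ r‖ ≤ K₄ + 1 / 2 := by
      have h2 := norm_le_norm_sub_add (amplitudeJ0 γ σ r) (1 / 2)
      rw [hhalf] at h2
      have : K₄ * r ≤ K₄ := mul_le_of_le_one_right hK₄0 hr1'
      linarith
    calc _ ≤ (K₄ + 1 / 2) * e := by gcongr
      _ ≤ _ := by
        refine mul_le_mul_of_nonneg_right ?_ (by positivity)
        linarith [mul_nonneg (mul_nonneg (by norm_num : (0 : ℝ) ≤ 8) hK) hL0]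
  · rw [norm_mul, ← mul_assoc]
    have h1 : r * ‖amplitudeJ1 γ σ r‖ ≤ K₃ + L := by
      have h2 := norm_le_norm_sub_add (amplitudeJ1 γ σ r) (leadingAmplitude γ σ r)
      rw [hlead] at h2
      calc _ ≤ r * (K₃ + L / r) := by gcongr; linarith
        _ = r * K₃ + L := by field_simp
        _ ≤ _ := by
          have : r * K₃ ≤ K₃ := mul_le_of_le_one_left hK₃0 hr1'
          linarith
    calc _ ≤ (K₃ + L) * e := by gcongr
      _ ≤ _ := by
        refine mul_le_mul_of_nonneg_right ?_ (by positivity)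
        linarith [mul_nonneg (mul_nonneg (by norm_num : (0 : ℝ) ≤ 8) hK) hL0]

lemma CharRoots.solutionFlow_apply (h : CharRoots γ K r s om l) (hγ : 1 < γ) (hr : 0 < r)
    (hr1 : r ≤ 1 / 4) (t : ℝ) (y₀ y₁ : ℂ) :
    (solutionFlow γ (r ^ 2) t (y₀, y₁, 0)).1 =
      ((oscRoot s om 1 + (r ^ 2 : ℝ)) * y₀ + y₁)
          * (oscCoeff γ s om l 1 * Complex.exp (oscRoot s om 1 * t))
        + ((oscRoot s om (-1) + (r ^ 2 : ℝ)) * y₀ + y₁)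
          * (oscCoeff γ s om l (-1) * Complex.exp (oscRoot s om (-1) * t))
        + (((-l : ℝ) + (r ^ 2 : ℝ)) * y₀ + y₁)
          * ((γ + (-l : ℝ)) / (((-l : ℝ) - oscRoot s om 1) * ((-l : ℝ) - oscRoot s om (-1)))
            * Complex.exp ((-l : ℝ) * t)) := by
  have hom := h.omega_pos hγ hr
  have v1 : (s : ℂ) + l = γ + r ^ 2 := by exact_mod_cast h.vieta_one
  have v2 : (s : ℂ) ^ 2 / 4 + om ^ 2 + s * l = (1 + γ) * r ^ 2 := by
    exact_mod_cast h.vieta_two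
  have v3 : ((s : ℂ) ^ 2 / 4 + om ^ 2) * l = (γ - 1) * r ^ 2 := by exact_mod_cast h.vieta_three
  have hmul : oscRoot s om 1 * oscRoot s om (-1) = s ^ 2 / 4 + om ^ 2 := by
    simp only [oscRoot]
    push_cast
    linear_combination -(om : ℂ) ^ 2 * Complex.I_sq
  have hadd : oscRoot s om 1 + oscRoot s om (-1) = -s := by
    simp only [oscRoot]
    push_cast
    ring
  have hne (σ : ℝ) : oscRoot s om σ - (-l : ℝ) ≠ 0 :=
    norm_ne_zero_iff.1 (by linarith [h.quarter_le_norm hγ hr hr1 σ])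
  have hne2 : oscRoot s om 1 - oscRoot s om (-1) ≠ 0 := by
    rw [oscRoot_sub_neg]
    simp [hom.ne']
  have := solutionFlow_apply_fst (γ := γ) (q := r ^ 2) t (l₁ := oscRoot s om 1)
    (l₂ := oscRoot s om (-1)) (l₃ := (-l : ℝ)) (by
      rw [hadd]; push_cast; linear_combination -v1)
    (by rw [add_assoc, ← add_mul, hmul, hadd]; push_cast; linear_combination v2)
    (by rw [hmul]; push_cast; linear_combination -v3)
    hne2 (hne 1) (hne (-1)) y₀ y₁
  rw [this, oscCoeff, oscCoeff, neg_neg]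

/-- The numerator `γ - l` is `O(r²)`, and the real root stays at distance at least `1/4` from the
pair. -/
lemma CharRoots.norm_decayCoeff_le (h : CharRoots γ K r s om l) (hγ : 1 < γ) (hK : 0 ≤ K)
    (hr : 0 < r) (hr1 : r ≤ 1 / 4) :
    ‖((γ : ℂ) + (-l : ℝ)) / (((-l : ℝ) - oscRoot s om 1) * ((-l : ℝ) - oscRoot s om (-1)))‖
      ≤ 16 * K := by
  have h1 := h.quarter_le_norm hγ hr hr1 1
  have h2 := h.quarter_le_norm hγ hr hr1 (-1)
  have hl := h.l_sub
  rw [norm_sub_rev] at h1 h2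
  rw [norm_div, norm_mul, ← Complex.ofReal_add, Complex.norm_real, Real.norm_eq_abs,
    ← sub_eq_add_neg, div_le_iff₀ (mul_pos (by linarith) (by linarith))]
  have : (1 / 4 : ℝ) * (1 / 4) ≤ ‖(-l : ℝ) - oscRoot s om 1‖ * ‖(-l : ℝ) - oscRoot s om (-1)‖ := by
    gcongr
  have hr2 : r ^ 2 ≤ 1 := by nlinarith
  calc |γ - l| ≤ K * 1 := hl.trans (by gcongr)
    _ = 16 * K * ((1 / 4 : ℝ) * (1 / 4)) := by ring
    _ ≤ _ := by gcongr

end Pointwise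

/-! ### The pointwise error bound with its decay in time. -/

section PointwiseBound

/-- The quantity `r √t e^{-r²t/8}` is bounded: half of the Gaussian exponent is spent to convert `r`
into `t^{-1/2}`. -/
lemma mul_exp_neg_quarter_le {r t : ℝ} (ht : 1 ≤ t) :
    r * Real.exp (-(r ^ 2 * t / 4)) ≤ 8 * ((√t)⁻¹ * Real.exp (-(r ^ 2 * t / 8))) := by
  have hst : 0 < √t := Real.sqrt_pos.2 (by linarith)
  have hsq : √t ^ 2 = t := Real.sq_sqrt (by linarith)
  have h1 := Real.add_one_le_exp (r ^ 2 * t / 8)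
  have h2 : Real.exp (-(r ^ 2 * t / 8))
      = Real.exp (r ^ 2 * t / 8) * Real.exp (-(r ^ 2 * t / 4)) := by
    rw [← Real.exp_add]; ring_nf
  rw [h2, ← mul_assoc, ← mul_assoc]
  refine mul_le_mul_of_nonneg_right ?_ (Real.exp_pos _).le
  rw [mul_right_comm, ← div_eq_mul_inv, le_div_iff₀ hst]
  have : (r * √t) ^ 2 = r ^ 2 * t := by rw [mul_pow, hsq]
  nlinarith [sq_nonneg (r * √t - 1)]

/-- For `r ≤ 1` the exponential decay of the real mode is better than both factors on the right, so
that mode fits into the same bound. -/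
lemma exp_neg_half_le {r t : ℝ} (hr0 : 0 ≤ r) (hr : r ≤ 1) (ht : 1 ≤ t) :
    Real.exp (-(t / 2)) ≤ 8 * ((√t)⁻¹ * Real.exp (-(r ^ 2 * t / 8))) := by
  have hst : 0 < √t := Real.sqrt_pos.2 (by linarith)
  have hsq : √t ^ 2 = t := Real.sq_sqrt (by linarith)
  have hr2 : r ^ 2 ≤ 1 := pow_le_one₀ hr0 hr
  have h1 := Real.add_one_le_exp (t / 4)
  have h2 : Real.exp (-(t / 4)) ≤ Real.exp (-(r ^ 2 * t / 8)) :=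
    Real.exp_le_exp.2 (by nlinarith)
  have h3 : Real.exp (-(t / 4)) = Real.exp (t / 4) * Real.exp (-(t / 2)) := by
    rw [← Real.exp_add]; ring_nf
  have h4 : Real.exp (-(t / 2)) ≤ 8 * ((√t)⁻¹ * Real.exp (-(t / 4))) := by
    rw [h3, ← mul_assoc, ← mul_assoc]
    refine le_mul_of_one_le_left (Real.exp_pos _).le ?_
    rw [mul_right_comm, ← div_eq_mul_inv, le_div_iff₀ hst]
    nlinarith [sq_nonneg (√t - 1)]
  refine h4.trans ?_
  gcongr

/-- The error splits into mode minus profile acting on the exact data, profile acting on the data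
minus their masses, and the decaying mode. The bounds on `x` and `m` carry a factor `r` because the
velocity profiles are of size `1/r`; the factor `r` in `hp₁` compensates it. -/
lemma norm_combination_le {y₀ y₁ p₀ p₁ a b c d e f x m : ℂ} {N₀ N₁ A₀ A₁ B₀ B₁ r M D : ℝ}
    (hr : 0 ≤ r) (hy₀ : ‖y₀‖ ≤ N₀) (hy₁ : ‖y₁‖ ≤ N₁) (hp₀ : ‖y₀ - p₀‖ ≤ r * N₀)
    (hp₁ : ‖y₁ - p₁‖ ≤ r * N₁) (h₀ : ‖a - c‖ ≤ A₀) (h₀' : ‖b - d‖ ≤ A₀)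
    (h₁ : ‖e - x‖ ≤ A₁) (h₁' : ‖f - m‖ ≤ A₁) (hc : ‖c‖ ≤ B₀) (hd : ‖d‖ ≤ B₀)
    (hx : r * ‖x‖ ≤ B₁) (hm : r * ‖m‖ ≤ B₁) {k w : ℂ} (hk : ‖k‖ ≤ M) (hw : ‖w‖ ≤ D) :
    ‖(a * y₀ + e * y₁) + (b * y₀ + f * y₁) + (k * y₀ + y₁) * w
        - (p₀ * (c + d) + p₁ * (x + m))‖
      ≤ N₀ * (2 * A₀ + 2 * (r * B₀) + M * D) + N₁ * (2 * A₁ + 2 * B₁ + D) := by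
  have hN₀ := (norm_nonneg _).trans hy₀
  have hN₁ := (norm_nonneg _).trans hy₁
  have hM := (norm_nonneg _).trans hk
  have hD := (norm_nonneg _).trans hw
  have e0 : (a * y₀ + e * y₁) + (b * y₀ + f * y₁) + (k * y₀ + y₁) * w
        - (p₀ * (c + d) + p₁ * (x + m))
      = y₀ * ((a - c) + (b - d)) + (y₀ - p₀) * (c + d)
        + (y₁ * ((e - x) + (f - m)) + (y₁ - p₁) * (x + m)) + (k * y₀ + y₁) * w := by ring
  have t1 : ‖y₀ * ((a - c) + (b - d))‖ ≤ N₀ * (A₀ + A₀) := by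
    rw [norm_mul]
    gcongr
    exact (norm_add_le _ _).trans (add_le_add h₀ h₀')
  have t2 : ‖(y₀ - p₀) * (c + d)‖ ≤ r * N₀ * (B₀ + B₀) := by
    rw [norm_mul]
    gcongr
    exact (norm_add_le _ _).trans (add_le_add hc hd)
  have t3 : ‖y₁ * ((e - x) + (f - m))‖ ≤ N₁ * (A₁ + A₁) := by
    rw [norm_mul]
    gcongr
    exact (norm_add_le _ _).trans (add_le_add h₁ h₁')
  have t4 : ‖(y₁ - p₁) * (x + m)‖ ≤ N₁ * (B₁ + B₁) := by
    rw [norm_mul]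
    calc _ ≤ r * N₁ * (‖x‖ + ‖m‖) := by gcongr; exact norm_add_le _ _
      _ = N₁ * (r * ‖x‖ + r * ‖m‖) := by ring
      _ ≤ _ := by gcongr
  have t5 : ‖(k * y₀ + y₁) * w‖ ≤ (M * N₀ + N₁) * D := by
    rw [norm_mul]
    gcongr
    refine (norm_add_le _ _).trans (add_le_add ?_ hy₁)
    rw [norm_mul]
    gcongr
  rw [e0]
  refine (norm_add_le _ _).trans ?_
  have := (norm_add_le (y₀ * ((a - c) + (b - d))) ((y₀ - p₀) * (c + d)))
  have := (norm_add_le (y₁ * ((e - x) + (f - m))) ((y₁ - p₁) * (x + m)))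
  have := (norm_add_le (y₀ * ((a - c) + (b - d)) + (y₀ - p₀) * (c + d))
    (y₁ * ((e - x) + (f - m)) + (y₁ - p₁) * (x + m)))
  linarith

/-- The low frequency asymptotics of the solution symbol, pointwise in the frequency. -/
lemma exists_pointwise_bound {γ : ℝ} (hγ : 1 < γ) :
    ∃ ε₀ B : ℝ, 0 < ε₀ ∧ ε₀ ≤ 1 / 4 ∧ 0 < B ∧ ∀ r t : ℝ, 0 < r → r < ε₀ → 1 ≤ t →
      ∀ (y₀ y₁ p₀ p₁ : ℂ) (N₀ N₁ : ℝ), ‖y₀‖ ≤ N₀ → ‖y₁‖ ≤ N₁ → ‖y₀ - p₀‖ ≤ r * N₀ →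
        ‖y₁ - p₁‖ ≤ r * N₁ →
        ‖(solutionFlow γ (r ^ 2) t (y₀, y₁, 0)).1
            - (p₀ * symbolJ0 γ t r + p₁ * symbolJ1 γ t r)‖
          ≤ B * ((√t)⁻¹ * N₀ + N₁) * Real.exp (-(r ^ 2 * t / 8)) := by
  obtain ⟨K, ε₀, hK, hε₀, hε₀4, hroots⟩ := exists_charRoots hγ
  obtain ⟨B, hB, hmode⟩ := exists_mode_bounds hγ hK.le
  -- The terms `32 * B` and `(γ + 1) * (16 * K) * 8` come from the part with `N₀`, the terms `4 * B`
  -- and `16 * K` from the part with `N₁`; their sum dominates both.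
  refine ⟨ε₀, 32 * B + 4 * B + (γ + 1) * (16 * K) * 8 + 16 * K, hε₀, hε₀4, by positivity,
    fun r t hr hrε ht y₀ y₁ p₀ p₁ N₀ N₁ hy₀ hy₁ hp₀ hp₁ => ?_⟩
  obtain ⟨s, om, l, h⟩ := hroots r hr hrε
  have hr4 : r ≤ 1 / 4 := hrε.le.trans hε₀4
  have ht0 : 0 ≤ t := by linarith
  obtain ⟨a1, a2, a3, a4⟩ := hmode r s om l h hr hr4 1 t (Or.inl rfl) ht0
  obtain ⟨b1, b2, b3, b4⟩ := hmode r s om l h hr hr4 (-1) t (Or.inr rfl) ht0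
  have hr2 : r ^ 2 ≤ 1 := by nlinarith
  have hk : ‖((-l : ℝ) : ℂ) + (r ^ 2 : ℝ)‖ ≤ γ + 1 := by
    rw [← Complex.ofReal_add, Complex.norm_real, Real.norm_eq_abs, abs_le]
    have := h.l_ge
    have := h.vieta_one
    have := h.s_ge
    constructor <;> nlinarith
  have hE : ‖Complex.exp (((-l : ℝ) : ℂ) * t)‖ ≤ Real.exp (-(t / 2)) := by
    rw [← Complex.ofReal_mul, Complex.norm_exp, Complex.ofReal_re, Real.exp_le_exp]
    have := h.l_ge
    nlinarith
  have hw := (norm_mul _ _).le.trans (mul_le_mul (h.norm_decayCoeff_le hγ hK.le hr hr4) hE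
    (norm_nonneg _) (by positivity))
  have key := norm_combination_le hr.le hy₀ hy₁ hp₀ hp₁ a1 b1 a2 b2 a3 b3 a4 b4 hk hw
  rw [h.solutionFlow_apply hγ hr hr4, symbolJ0, symbolJ1]
  have hN₀ := (norm_nonneg _).trans hy₀
  have hN₁ := (norm_nonneg _).trans hy₁
  have f1 := mul_exp_neg_quarter_le (r := r) ht
  have f2 := exp_neg_half_le hr.le (by linarith : r ≤ 1) ht
  have f3 : Real.exp (-(r ^ 2 * t / 4)) ≤ Real.exp (-(r ^ 2 * t / 8)) :=
    Real.exp_le_exp.2 (by nlinarith [mul_nonneg (sq_nonneg r) ht0])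
  have f4 : Real.exp (-(t / 2)) ≤ Real.exp (-(r ^ 2 * t / 8)) :=
    Real.exp_le_exp.2 (by nlinarith)
  have hγ1 : 0 ≤ γ + 1 := by linarith
  have hg : 0 ≤ (√t)⁻¹ * Real.exp (-(r ^ 2 * t / 8)) := by positivity
  have he := (Real.exp_pos (-(r ^ 2 * t / 8))).le
  set g := (√t)⁻¹ * Real.exp (-(r ^ 2 * t / 8)) with hgdef
  set e8 := Real.exp (-(r ^ 2 * t / 8))
  set e4 := Real.exp (-(r ^ 2 * t / 4))
  set et := Real.exp (-(t / 2))
  refine (le_of_eq ?_).trans (key.trans ?_)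
  · congr 1
    ring
  · have g1 : 2 * (B * (r * e4)) + 2 * (r * (B * e4)) + (γ + 1) * (16 * K * et)
        ≤ (32 * B + (γ + 1) * (16 * K) * 8) * g := by
      calc _ = 4 * B * (r * e4) + (γ + 1) * (16 * K) * et := by ring
        _ ≤ 4 * B * (8 * g) + (γ + 1) * (16 * K) * (8 * g) := by gcongr
        _ = _ := by ring
    have g2 : 2 * (B * e4) + 2 * (B * e4) + 16 * K * et ≤ (4 * B + 16 * K) * e8 := by
      calc _ = 4 * B * e4 + 16 * K * et := by ring
        _ ≤ 4 * B * e8 + 16 * K * e8 := by gcongr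
        _ = _ := by ring
    calc _ ≤ N₀ * ((32 * B + (γ + 1) * (16 * K) * 8) * g) + N₁ * ((4 * B + 16 * K) * e8) := by
          gcongr
      _ ≤ N₀ * ((32 * B + 4 * B + (γ + 1) * (16 * K) * 8 + 16 * K) * g)
          + N₁ * ((32 * B + 4 * B + (γ + 1) * (16 * K) * 8 + 16 * K) * e8) := by
          have : 0 ≤ (γ + 1) * (16 * K) * 8 := by positivity
          refine add_le_add (mul_le_mul_of_nonneg_left (mul_le_mul_of_nonneg_right ?_ hg) hN₀)
            (mul_le_mul_of_nonneg_left (mul_le_mul_of_nonneg_right ?_ he) hN₁) <;> linarith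
      _ = _ := by rw [hgdef]; ring

end PointwiseBound

/-! ### The cut-off in the unscaled frequency variable. -/

section Cutoff

variable {n : ℕ}

/-- The multiplier of `frequencyCutoff χ`. -/
def cutoffSymbol (χ : Rn n → ℝ) (ξ : Rn n) : ℂ := ((χ ((2 * Real.pi) • ξ) : ℝ) : ℂ)

lemma IsLowCutoff.norm_smul_lt {ε : ℝ} {χ : Rn n → ℝ} (hχ : IsLowCutoff ε χ) {ξ : Rn n}
    (h : cutoffSymbol χ ξ ≠ 0) : 2 * Real.pi * ‖ξ‖ < ε := by
  have h1 : χ ((2 * Real.pi) • ξ) ≠ 0 := fun h0 => h (by rw [cutoffSymbol, h0, Complex.ofReal_zero])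
  have h2 := mem_ball_zero_iff.1 (hχ.support (subset_tsupport _ h1))
  rwa [norm_smul, Real.norm_of_nonneg (by positivity)] at h2

lemma IsLowCutoff.tsupport_cutoffSymbol_subset {ε : ℝ} {χ : Rn n → ℝ} (hχ : IsLowCutoff ε χ)
    (hε : ε ≤ 1 / 4) :
    tsupport (cutoffSymbol χ) ⊆ Metric.closedBall 0 (1 / (4 * Real.pi)) := by
  refine closure_minimal (fun ξ hξ => ?_) Metric.isClosed_closedBall
  rw [mem_closedBall_zero_iff, le_div_iff₀ (by positivity)]
  have := hχ.norm_smul_lt hξ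
  linarith

lemma IsLowCutoff.hasTemperateGrowth {ε : ℝ} {χ : Rn n → ℝ} (hχ : IsLowCutoff ε χ)
    (hε : ε ≤ 1 / 4) : (cutoffSymbol χ).HasTemperateGrowth := by
  refine HasCompactSupport.hasTemperateGrowth
    ((isCompact_closedBall _ _).of_isClosed_subset (isClosed_tsupport _)
      (hχ.tsupport_cutoffSymbol_subset hε)) ?_
  exact Complex.ofRealCLM.contDiff.comp (hχ.smooth.comp (contDiff_id.const_smul _))

lemma IsLowCutoff.exists_norm_le {ε : ℝ} {χ : Rn n → ℝ} (hχ : IsLowCutoff ε χ)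
    (hε : ε ≤ 1 / 4) : ∃ M : ℝ, 0 < M ∧ ∀ ξ, ‖cutoffSymbol χ ξ‖ ≤ M := by
  have hs : HasCompactSupport (cutoffSymbol χ) :=
    (isCompact_closedBall _ _).of_isClosed_subset (isClosed_tsupport _)
      (hχ.tsupport_cutoffSymbol_subset hε)
  obtain ⟨M, hM⟩ := hs.exists_bound_of_continuous (hχ.hasTemperateGrowth hε).1.continuous
  exact ⟨M + 1, by linarith [(norm_nonneg _).trans (hM 0)], fun ξ => (hM ξ).trans (by linarith)⟩

end Cutoff

/-! ### The `L²` norm of a Gaussian bound. -/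

section Gaussian

/-- A function bounded by `A exp (-(2π|ξ|)² t / 8)` has `L²` norm at most `A t^{-n/4}`. -/
lemma norm_toLp_le_of_le_gaussian {n : ℕ} {h : Rn n → ℂ} (hm : AEStronglyMeasurable h volume)
    {A t : ℝ} (hA : 0 ≤ A) (ht : 0 < t)
    (hle : ∀ᵐ ξ, ‖h ξ‖ ≤ A * Real.exp (-((2 * Real.pi * ‖ξ‖) ^ 2 * t / 8))) :
    ∃ hL : MemLp h 2 (volume : Measure (Rn n)), ‖hL.toLp h‖ ≤ A * t ^ (-((n : ℝ) / 4)) := by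
  -- Squaring doubles the exponent: `2 (2π)² t / 8 = π² t`.
  set b : ℝ := Real.pi ^ 2 * t with hb
  have hb0 : 0 < b := by positivity
  have hint : Integrable (fun ξ : Rn n => Real.exp (-b * ‖ξ‖ ^ 2)) := by
    have hc : 0 < ((b : ℝ) : ℂ).re := by rwa [Complex.ofReal_re]
    refine (GaussianFourier.integrable_cexp_neg_mul_sq_norm_add (V := Rn n) hc 0 0).norm.congr
      (Eventually.of_forall fun ξ => ?_)
    simp only [Complex.norm_exp]
    congr 1
    simp [← Complex.ofReal_pow]
  have hsq : ∀ᵐ ξ : Rn n, ‖h ξ‖ ^ 2 ≤ A ^ 2 * Real.exp (-b * ‖ξ‖ ^ 2) := by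
    filter_upwards [hle] with ξ hξ
    refine (pow_le_pow_left₀ (norm_nonneg _) hξ 2).trans (le_of_eq ?_)
    rw [mul_pow, ← Real.exp_nat_mul, hb]
    congr 2
    push_cast
    ring
  have hL : MemLp h 2 (volume : Measure (Rn n)) := by
    rw [memLp_two_iff_integrable_sq_norm hm]
    refine (hint.const_mul (A ^ 2)).mono' (hm.norm.pow 2) ?_
    filter_upwards [hsq] with ξ hξ
    rwa [Real.norm_of_nonneg (by positivity)]
  refine ⟨hL, ?_⟩
  have hI : ∫ ξ, ‖h ξ‖ ^ 2 ≤ A ^ 2 * (t ^ (-((n : ℝ) / 4))) ^ 2 := by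
    calc _ ≤ ∫ ξ : Rn n, A ^ 2 * Real.exp (-b * ‖ξ‖ ^ 2) :=
          integral_mono_ae ((memLp_two_iff_integrable_sq_norm hm).1 hL) (hint.const_mul _) hsq
      _ = A ^ 2 * (Real.pi / b) ^ ((n : ℝ) / 2) := by
          rw [integral_const_mul, GaussianFourier.integral_rexp_neg_mul_sq_norm hb0,
            finrank_euclideanSpace_fin]
      _ ≤ A ^ 2 * (t⁻¹) ^ ((n : ℝ) / 2) := by
          gcongr
          rw [hb, inv_eq_one_div, div_le_div_iff₀ hb0 ht]
          nlinarith [Real.pi_gt_three, mul_pos Real.pi_pos ht]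
      _ = _ := by
          rw [Real.inv_rpow ht.le, ← Real.rpow_neg ht.le, ← Real.rpow_mul_natCast ht.le]
          congr 2
          push_cast
          ring
  rw [Lp.norm_toLp, hL.eLpNorm_eq_integral_rpow_norm (by norm_num) (by norm_num),
    ENNReal.toReal_ofReal (by positivity)]
  simp only [ENNReal.toReal_ofNat, Real.rpow_two]
  rw [← one_div, ← Real.sqrt_eq_rpow]
  refine Real.sqrt_le_iff.2 ⟨by positivity, ?_⟩
  rw [mul_pow]
  exact hI

end Gaussian

/-! ### The error as an inverse Fourier transform. -/

section Error

variable {n : ℕ}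

/-- The Fourier transform of the leading profile `P₀ J₀ + P₁ J₁`. -/
def profileSymbol (γ : ℝ) (p₀ p₁ : ℂ) (t : ℝ) (ξ : Rn n) : ℂ :=
  p₀ * symbolJ0 γ t (2 * Real.pi * ‖ξ‖) + p₁ * symbolJ1 γ t (2 * Real.pi * ‖ξ‖)

lemma memLp_profileSymbol {γ t : ℝ} (hγ : 1 < γ) (ht : 0 < t) (p₀ p₁ : ℂ) :
    MemLp (profileSymbol (n := n) γ p₀ p₁ t) 2 :=
  ((memLp_symbolJ0 n hγ ht).const_mul p₀).add ((memLp_symbolJ1 n hγ ht).const_mul p₁)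

lemma fourier_profile {γ t : ℝ} (hγ : 1 < γ) (ht : 0 < t) (p₀ p₁ : ℂ) :
    𝓕 (p₀ • profileJ0 n hγ ht + p₁ • profileJ1 n hγ ht)
      = (memLp_profileSymbol hγ ht p₀ p₁).toLp _ := by
  rw [FourierTransform.fourier_add, FourierTransform.fourier_smul, FourierTransform.fourier_smul,
    profileJ0, profileJ1, FourierTransform.fourier_fourierInv_eq,
    FourierTransform.fourier_fourierInv_eq]
  rfl

lemma continuous_solutionSymbol {γ : ℝ} {u₀ u₁ : Rn n → ℂ} (hu₀ : Integrable u₀)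
    (hu₁ : Integrable u₁) (t : ℝ) : Continuous (solutionSymbol γ u₀ u₁ t) := by
  have h0 := continuous_fourier_of_integrable hu₀
  have h1 := continuous_fourier_of_integrable hu₁
  have h2 := continuous_freqSq (n := n)
  have h3 : Continuous fun ξ => solutionFlow γ (freqSq ξ : ℝ) t :=
    (continuous_propagator (generatorConst γ) generatorSq).comp (h2.prodMk continuous_const)
  exact continuous_fst.comp (h3.clm_apply (h0.prodMk (h1.prodMk continuous_const)))

/-- The error `χ(D) (u - P₀ J₀ - P₁ J₁)` is the inverse Fourier transform of its symbol. -/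
lemma IsSolution.frequencyCutoff_sub_profile {γ : ℝ} (hγ : 1 < γ) {u₀ u₁ : Rn n → ℂ}
    (hu₀ : Integrable u₀) (hu₁ : Integrable u₁) {u : ℝ → 𝓢'(Rn n, ℂ)}
    (hu : IsSolution γ u₀ u₁ u) {ε : ℝ} (hε : ε ≤ 1 / 4) {χ : Rn n → ℝ} (hχ : IsLowCutoff ε χ)
    {t : ℝ} (ht : 0 < t) (p₀ p₁ : ℂ)
    (hL : MemLp (fun ξ => cutoffSymbol χ ξ *
      (solutionSymbol γ u₀ u₁ t ξ - profileSymbol γ p₀ p₁ t ξ)) 2) :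
    Lp.toTemperedDistribution (𝓕⁻ (hL.toLp _)) = frequencyCutoff χ
      (u t - Lp.toTemperedDistribution (p₀ • profileJ0 n hγ ht + p₁ • profileJ1 n hγ ht)) := by
  have hg := hχ.hasTemperateGrowth hε
  rw [← Lp.fourierInv_toTemperedDistribution_eq, frequencyCutoff,
    TemperedDistribution.fourierMultiplierCLM_apply]
  congr 1
  ext φ
  change _ = TemperedDistribution.smulLeftCLM ℂ (cutoffSymbol χ) _ φ
  rw [TemperedDistribution.smulLeftCLM_apply_apply]
  -- The cut-off moves onto the test function, which becomes supported at low frequencies; there the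
  -- solution is given by its symbol.
  set ψ := SchwartzMap.smulLeftCLM ℂ (cutoffSymbol χ) φ with hψ
  have hψs : tsupport ψ ⊆ tsupport (cutoffSymbol χ) :=
    (SchwartzMap.tsupport_smulLeftCLM_subset _ _).trans inter_subset_right
  have hψc : HasCompactSupport ψ :=
    (isCompact_closedBall _ _).of_isClosed_subset (isClosed_tsupport _)
      (hψs.trans (hχ.tsupport_cutoffSymbol_subset hε))
  have i1 : Integrable fun ξ => ψ ξ * solutionSymbol γ u₀ u₁ t ξ :=
    (ψ.continuous.mul (continuous_solutionSymbol hu₀ hu₁ t)).integrable_of_hasCompactSupport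
      hψc.mul_right
  have i2 : Integrable fun ξ => ψ ξ * profileSymbol γ p₀ p₁ t ξ :=
    (ψ.memLp 2).integrable_mul (memLp_profileSymbol hγ ht p₀ p₁)
  change _ = u t (𝓕 ψ) - (𝓕 (Lp.toTemperedDistribution
    (p₀ • profileJ0 n hγ ht + p₁ • profileJ1 n hγ ht))) ψ
  rw [Lp.fourier_toTemperedDistribution_eq, fourier_profile, hu.apply_fourier hγ hu₀ hu₁ (hψs.trans (hχ.tsupport_cutoffSymbol_subset hε)) ht.le,
    Lp.toTemperedDistribution_apply, Lp.toTemperedDistribution_apply]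
  have e2 : ∫ ξ, ψ ξ • ((memLp_profileSymbol hγ ht p₀ p₁).toLp _) ξ
      = ∫ ξ, ψ ξ * profileSymbol γ p₀ p₁ t ξ := by
    refine integral_congr_ae ?_
    filter_upwards [(memLp_profileSymbol (n := n) hγ ht p₀ p₁).coeFn_toLp] with ξ hξ
    rw [hξ, smul_eq_mul]
  rw [e2, ← integral_sub i1 i2]
  refine integral_congr_ae ?_
  filter_upwards [hL.coeFn_toLp] with ξ hξ
  rw [hξ, hψ, SchwartzMap.smulLeftCLM_apply_apply hg, smul_eq_mul, smul_eq_mul]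
  ring

end Error

end ViscoelasticMemory

end

/-! ### The low frequency estimate. -/

open ViscoelasticMemory in
theorem mainTheorem3 (n : ℕ) (hn : 1 ≤ n) (γ : ℝ) (hγ : 1 < γ) :
    ∃ ε₀ : ℝ, 0 < ε₀ ∧ ∀ ε : ℝ, 0 < ε → ε ≤ ε₀ →
      ∀ χ : ViscoelasticMemory.Rn n → ℝ, ViscoelasticMemory.IsLowCutoff ε χ →
        ∃ C T : ℝ, 0 < C ∧ 1 ≤ T ∧
          ∀ u₀ u₁ : ViscoelasticMemory.Rn n → ℂ,
            ViscoelasticMemory.MemL11 u₀ → ViscoelasticMemory.MemL11 u₁ →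
            ∀ u : ℝ → 𝓢'(ViscoelasticMemory.Rn n, ℂ),
              ViscoelasticMemory.IsSolution γ u₀ u₁ u →
              ∀ (t : ℝ) (ht : 0 < t), T ≤ t →
                ∃ w : Lp ℂ 2 (volume : Measure (ViscoelasticMemory.Rn n)),
                  Lp.toTemperedDistribution w =
                    ViscoelasticMemory.frequencyCutoff χ
                      (u t - Lp.toTemperedDistribution
                        ((∫ x, u₀ x) • ViscoelasticMemory.profileJ0 n hγ ht
                          + (∫ x, u₁ x) • ViscoelasticMemory.profileJ1 n hγ ht)) ∧
                  ‖w‖ ≤ C * (t ^ (-(1 / 2 : ℝ) - (n : ℝ) / 4) * ViscoelasticMemory.normL11 u₀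
                    + t ^ (-((n : ℝ) / 4)) * ViscoelasticMemory.normL11 u₁) := by
  obtain ⟨ε₀, B, hε₀, hε₀4, hB, hpt⟩ := exists_pointwise_bound hγ
  refine ⟨ε₀, hε₀, fun ε _ hεle χ hχ => ?_⟩
  have hε4 : ε ≤ 1 / 4 := hεle.trans hε₀4
  obtain ⟨M, hM, hχM⟩ := hχ.exists_norm_le hε4
  refine ⟨M * B, 1, by positivity, le_rfl, fun u₀ u₁ hu₀ hu₁ u hu t ht ht1 => ?_⟩
  set N₀ := normL11 u₀
  set N₁ := normL11 u₁
  have hN₀ : 0 ≤ N₀ := (norm_nonneg _).trans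
    ((norm_fourier_le_integral u₀ 0).trans (integral_norm_le_normL11 hu₀))
  have hN₁ : 0 ≤ N₁ := (norm_nonneg _).trans
    ((norm_fourier_le_integral u₁ 0).trans (integral_norm_le_normL11 hu₁))
  -- Positive dimension makes points null sets, so the origin can be discarded.
  have : Nonempty (Fin n) := ⟨⟨0, hn⟩⟩
  set h : Rn n → ℂ := fun ξ => cutoffSymbol χ ξ *
    (solutionSymbol γ u₀ u₁ t ξ - profileSymbol γ (∫ x, u₀ x) (∫ x, u₁ x) t ξ) with hh
  have hm : AEStronglyMeasurable h volume :=
    (hχ.hasTemperateGrowth hε4).1.continuous.aestronglyMeasurable.mul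
      ((continuous_solutionSymbol hu₀.1 hu₁.1 t).aestronglyMeasurable.sub
        (memLp_profileSymbol hγ ht _ _).1)
  have hle : ∀ᵐ ξ, ‖h ξ‖ ≤ M * (B * ((√t)⁻¹ * N₀ + N₁))
      * Real.exp (-((2 * Real.pi * ‖ξ‖) ^ 2 * t / 8)) := by
    -- The origin is excluded because the roots `-s/2 ± i om` merge there and the pointwise bound
    -- requires `r > 0`.
    filter_upwards [compl_mem_ae_iff.2 (measure_singleton (0 : Rn n))] with ξ hξ
    have hξ0 : 0 < ‖ξ‖ := norm_pos_iff.2 hξ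
    by_cases hc : cutoffSymbol χ ξ = 0
    · rw [hh]
      simp only [hc, zero_mul, norm_zero]
      positivity
    · rw [mul_assoc, hh, norm_mul]
      refine mul_le_mul (hχM ξ) (hpt _ t (by positivity) ((hχ.norm_smul_lt hc).trans_le hεle) ht1
        _ _ _ _ _ _ ((norm_fourier_le_integral u₀ ξ).trans (integral_norm_le_normL11 hu₀))
        ((norm_fourier_le_integral u₁ ξ).trans (integral_norm_le_normL11 hu₁))
        (norm_fourier_sub_integral_le hu₀ ξ) (norm_fourier_sub_integral_le hu₁ ξ))
        (norm_nonneg _) hM.le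
  obtain ⟨hL, hnorm⟩ := norm_toLp_le_of_le_gaussian hm (by positivity) ht hle
  refine ⟨𝓕⁻ (hL.toLp h), hu.frequencyCutoff_sub_profile hγ hu₀.1 hu₁.1 hε4 hχ ht _ _ hL, ?_⟩
  -- By Plancherel, in the normalization with `2π` in the exponent, no constant appears.
  rw [← Lp.norm_fourier_eq, FourierTransform.fourier_fourierInv_eq]
  refine hnorm.trans (le_of_eq ?_)
  rw [sub_eq_add_neg, Real.rpow_add ht, Real.rpow_neg ht.le (1 / 2), ← Real.sqrt_eq_rpow]
  ring
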